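/- **Definitions.** An operator-valued $C^*$-probability space $(\mathcal A,E,\mathcal B)$ consists of a unital $C^*$-algebra $\mathcal A$, a unital $C^*$-subalgebra $\mathcal B\subseteq\mathcal A$, and a completely positive conditional expectation $E:\mathcal A\to\mathcal B$, that is, $E[b]=b$ and $E[b_1ab_2]=b_1E[a]b_2$ for $b,b_1,b_2\in\mathcal B$, $a\in\mathcal A$. Elements $x_1,\dots,x_n\in\mathcal A$ are Boolean independent over $\mathcal B$ if $E[a_1\cdots a_m]=E[a_1]\cdots E[a_m]$ whenever $a_k\in\mathcal A_{x_{i_k}}$ and $i_1\ne i_2\neq\dots\ne i_m$, where $\mathcal A_{x}$ is the (non-unital) subalgebra of finite sums of elements $b_1xb_2x\cdots xb_{k+1}$ with $k\ge1$, $b_i\in\mathcal B$. A $\mathcal B$-valued Bernoulli element with variance $\eta:\mathcal B\to\mathcal B$ is an element $y$ of some operator-valued $C^*$-probability space over $\mathcal B$ (whose conditional expectation is again written $E$) such that $E[y]=0$ and, for all $b_0,\dots,b_k\in\mathcal B$, $E[b_0yb_1y\cdots yb_k]$ equals $b_0\eta(b_1)b_2\eta(b_3)\cdots\eta(b_{k-1})b_k$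 if $k$ is even and $0$ if $k$ is odd. Let $\mathbb H^+(\mathcal B)$ be the set of $\mathfrak b\in\mathcal B$ for which $\Im m(\mathfrak b)=\frac1{2i}(\mathfrak b-\mathfrak b^*)$ is positive and invertible, and for $\mathfrak b\in\mathbb H^+(\mathcal B)$ and self-adjoint $x$ put $G_x(\mathfrak b)=(\mathfrak b-x)^{-1}$. **Theorem.** There is a universal constant $c>0$ such that the following holds. Let $(\mathcal A,E,\mathcal B)$ be an operator-valued $C^*$-probability space, let $n\ge1$, and let $x_1,\dots,x_n\in\mathcal A$ be self-adjoint and Boolean independent over $\mathcal B$ with $E[x_j]=0$ for all $j$. Put $$X_n=\frac1{\sqrt n}\sum_{j=1}^nx_j,\qquad \eta_n(b)=\frac1n\sum_{j=1}^nE[x_jbx_j]\quad(b\in\mathcal B),$$ $$\alpha_2=\max_{i}\|E[x_i^2]\|,\qquad \alpha_4=\max_i\sup_{b\in\mathcal B,\ \|b\|=1}\|E[x_ib^*x_i^2bx_i]\|,\qquad \widetilde\alpha_4=\max_i\|E[x_i^4]\|,$$ and let $B_n$ be a self-adjoint $\mathcal B$-valued Bernoulli element with variance $\eta_n$. Then,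 for every $\mathfrak b\in\mathbb H^+(\mathcal B)$, $$\big\|E[G_{X_n}(\mathfrak b)]-E[G_{B_n}(\mathfrak b)]\big\|\le\frac1{\sqrt n}\,\|\Im m(\mathfrak b)^{-1}\|^4\,\sqrt{\alpha_2}\,\big(\sqrt{\alpha_4}+\alpha_2\big).$$ Furthermore, let $\varphi$ be a state with $\varphi=\varphi\circ E$ (on the algebra of $X_n$ and on that of $B_n$, with the same restriction to $\mathcal B$), and let $\mu_{X_n},\mu_{B_n}$ be the distributions of $X_n,B_n$ with respect to $\varphi$, that is, the Borel probability measures on $\mathbb R$ with $\int f\,d\mu_X=\varphi(f(X))$ for all continuous compactly supported $f:\mathbb R\to\mathbb R$. Then $$L(\mu_{X_n},\mu_{B_n})\le c\,\big(\alpha_2(\widetilde\alpha_4+\alpha_2^2)\big)^{1/14}\,n^{-1/14},$$ where $L(\mu,\nu)=\inf\{\epsilon>0:\ \mu((-\infty,t-\epsilon])-\epsilon\le\nu((-\infty,t])\le\mu((-\infty,t+\epsilon])+\epsilon\ \text{ for all }t\in\mathbb R\}$ is the Lévy distance. -/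

import Mathlib

open scoped ComplexOrder ComplexStarModule CompactlySupported

noncomputable section

/-- An operator-valued C*-probability space `(A, E, B)`: a unital C*-algebra `A`, a unital
C*-subalgebra `B` of `A`, given by its inclusion `incl : B → A`, and a completely positive
conditional expectation `E : A → B`. (That `incl` is injective follows from `E_incl`.) -/
structure OVCStarProbSpace (A B : Type*) [CStarAlgebra A] [PartialOrder A] [StarOrderedRing A]
    [CStarAlgebra B] [PartialOrder B] [StarOrderedRing B] where
  /-- the inclusion of `B` into `A` -/
  incl : B →⋆ₐ[ℂ] A
  /-- the conditional expectation -/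
  E : CompletelyPositiveMap A B
  E_incl : ∀ b : B, E (incl b) = b
  E_bimodule : ∀ (b₁ b₂ : B) (a : A), E (incl b₁ * a * incl b₂) = b₁ * E a * b₂

namespace OVCStarProbSpace

variable {A B : Type*} [CStarAlgebra A] [PartialOrder A] [StarOrderedRing A]
  [CStarAlgebra B] [PartialOrder B] [StarOrderedRing B]

/-- The (non-unital) `B`-bimodule subalgebra of `A` generated by `x`: the linear span of the
elements `b₁ x b₂ x ⋯ x bₙ₊₁` with `n ≥ 1` and `bᵢ ∈ B`. -/
def bimoduleAlgebra (P : OVCStarProbSpace A B) (x : A) : NonUnitalSubalgebra ℂ A :=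
  NonUnitalAlgebra.adjoin ℂ {a | ∃ b b' : B, a = P.incl b * x * P.incl b'}

/-- Boolean independence over `B` of a family of subalgebras: `E[a₁ ⋯ aₘ] = E[a₁] ⋯ E[aₘ]`
whenever `aₖ ∈ S (iₖ)` with `i₁ ≠ i₂ ≠ ⋯ ≠ iₘ`. The list `l` is `(i₁, a₁), …, (iₘ, aₘ)`. -/
def BooleanIndepAlgebras (P : OVCStarProbSpace A B) {I : Type*}
    (S : I → NonUnitalSubalgebra ℂ A) : Prop :=
  ∀ l : List (I × A), l.IsChain (fun p q => p.1 ≠ q.1) → (∀ p ∈ l, p.2 ∈ S p.1) →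
    P.E (l.map (fun p => p.2)).prod = (l.map (fun p => P.E p.2)).prod

/-- Boolean independence over `B` of a family of elements. -/
def BooleanIndep (P : OVCStarProbSpace A B) {I : Type*} (x : I → A) : Prop :=
  P.BooleanIndepAlgebras (fun i => P.bimoduleAlgebra (x i))

/-- The right-hand side of the moment formula of a Bernoulli element, on `[b₁, …, bₖ]`:
`η(b₁) b₂ η(b₃) b₄ ⋯ η(bₖ₋₁) bₖ` if `k` is even, and `0` if `k` is odd. -/
def bernoulliMoment (η : B → B) : List B → B
  | [] => 1
  | [_] => 0
  | b :: b' :: l => η b * b' * bernoulliMoment η l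

/-- `x` is a (centered) `B`-valued Bernoulli element with variance `η`:
`E[b₀ x b₁ x b₂ ⋯ x bₖ] = b₀ η(b₁) b₂ η(b₃) ⋯ η(bₖ₋₁) bₖ` for `k` even, `0` for `k` odd. -/
def IsBernoulli (P : OVCStarProbSpace A B) (η : B → B) (x : A) : Prop :=
  P.E x = 0 ∧ ∀ (b₀ : B) (l : List B),
    P.E (P.incl b₀ * (l.map (fun b => x * P.incl b)).prod) = b₀ * bernoulliMoment η l

/-- The operator-valued Cauchy transform `b ↦ E[G_x(b)] = E[(b - x)⁻¹]`. -/
def cauchyTransform (P : OVCStarProbSpace A B) (x : A) (b : B) : B :=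
  P.E (Ring.inverse (P.incl b - x))

/-- `α₂(x) = max_i ‖E[x_i²]‖`. -/
def alpha₂ (P : OVCStarProbSpace A B) {n : ℕ} (x : Fin n → A) : ℝ :=
  ⨆ i, ‖P.E (x i ^ 2)‖

/-- `α₄(x) = max_i sup_{‖b‖ = 1} ‖E[x_i b* x_i² b x_i]‖`. -/
def alpha₄ (P : OVCStarProbSpace A B) {n : ℕ} (x : Fin n → A) : ℝ :=
  ⨆ i, ⨆ b : {b : B // ‖b‖ = 1},
    ‖P.E (x i * P.incl (star b.1) * x i ^ 2 * P.incl b.1 * x i)‖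

/-- `α̃₄(x) = max_i ‖E[x_i⁴]‖`. -/
def alphaTilde₄ (P : OVCStarProbSpace A B) {n : ℕ} (x : Fin n → A) : ℝ :=
  ⨆ i, ‖P.E (x i ^ 4)‖

/-- The normalized sum `X_n = n^{-1/2} ∑ x_j`. -/
def normalizedSum {n : ℕ} (x : Fin n → A) : A := (√(n : ℝ))⁻¹ • ∑ j, x j

/-- The averaged variance `η_n(b) = n⁻¹ ∑ E[x_j b x_j]`. -/
def avgVariance (P : OVCStarProbSpace A B) {n : ℕ} (x : Fin n → A) (b : B) : B :=
  (n : ℝ)⁻¹ • ∑ j, P.E (x j * P.incl b * x j)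

end OVCStarProbSpace

/-- The operator upper half-plane `ℍ⁺(B)`: the `b` for which `Im b = (b - b*)/(2i)` is positive
and invertible. -/
def opUpperHalfPlane (B : Type*) [CStarAlgebra B] [PartialOrder B] : Set B :=
  {b | IsStrictlyPositive (ℑ b : B)}

section Distribution

variable {A : Type*} [CStarAlgebra A] [PartialOrder A] [StarOrderedRing A]

/-- The positive functional `f ↦ φ(f(x))` on `C_c(ℝ)`, through the continuous functional calculus
of the self-adjoint element `x`. -/
def calculusFunctional (φ : A →ₚ[ℂ] ℂ) (x : A) : C_c(ℝ, ℝ) →ₚ[ℝ] ℝ where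
  toFun f := (φ (cfc (fun t : ℝ => f t) x)).re
  map_add' f g := by
    have h := cfc_add (a := x) (fun t : ℝ => f t) (fun t : ℝ => g t)
      f.continuous.continuousOn g.continuous.continuousOn
    simp only [CompactlySupportedContinuousMap.coe_add, Pi.add_apply]
    rw [h, map_add, Complex.add_re]
  map_smul' r f := by
    have h := cfc_smul (a := x) r (fun t : ℝ => f t) f.continuous.continuousOn
    simp only [CompactlySupportedContinuousMap.coe_smul, Pi.smul_apply, RingHom.id_apply]
    rw [h, ← Complex.coe_smul, map_smul]
    simp
  monotone' f g hfg := by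
    have h : cfc (fun t : ℝ => f t) x ≤ cfc (fun t : ℝ => g t) x :=
      cfc_mono (fun t _ => hfg t) f.continuous.continuousOn g.continuous.continuousOn
    exact (Complex.le_def.mp (OrderHomClass.mono φ h)).1

/-- The distribution `μ_x` of a self-adjoint `x ∈ A` with respect to the state `φ`: the Borel
measure on `ℝ` with `∫ f dμ_x = φ(f(x))` for `f ∈ C_c(ℝ)`. -/
def distributionOf (φ : A →ₚ[ℂ] ℂ) (x : A) : MeasureTheory.Measure ℝ :=
  RealRMK.rieszMeasure (calculusFunctional φ x)

end Distribution

/-- The Lévy distance of two (probability) measures on `ℝ`. -/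
def levyDist (μ ν : MeasureTheory.Measure ℝ) : ℝ :=
  sInf {ε : ℝ | 0 < ε ∧ ∀ t : ℝ, μ.real (Set.Iic (t - ε)) - ε ≤ ν.real (Set.Iic t) ∧
    ν.real (Set.Iic t) ≤ μ.real (Set.Iic (t + ε)) + ε}

end

/-! Fix `b` in the upper half-plane and put `s = ‖(Im b)⁻¹‖`, `r = 1/√n`, `y_i = r x_i`, `g = b⁻¹`.
Both Cauchy transforms are inverses of `b` minus a self-energy, and the proof compares the
self-energies.

For the sum, solve `(b - y_i) u_i = y_i - β_i` with `E[u_i] = 0` and `β_i ∈ B`. Then `(b - X_n)(1 +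
∑ u_j) = b - ∑ β_i - ∑_{i ≠ j} y_i u_j`. Multiplying on the left by the resolvent of `X_n` and
applying `E`, Boolean independence kills the cross terms, since `E[R y_i u_j] = E[R y_i] E[u_j] =
0`. Hence `E[R] (b - ∑ β_i) = 1` (`BooleanIndep.cauchyTransform_sum_mul`): self-energies add. For
the Bernoulli element the moment formula gives `(b - η_n(g)) E[R'] = 1`
(`IsBernoulli.mul_cauchyTransform`). Therefore `E[R] - E[R'] = E[R] D E[R']` with `D = ∑ (β_i -
E[y_i g y_i])`.

Each summand of `D` equals `E[y_i g y_i u_i]`. Cauchy–Schwarz for `E`, together with the energy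
estimate `‖E[u_i* u_i]‖^{1/2} ≤ s ‖E[y_i²]‖^{1/2}`, makes it of order `r³`, so `D` is of order
`n^{-1/2}`. The two outer factors have norm at most `s`, which gives the first bound.

For the Lévy distance take `b = u + iε`. A uniform bound on the difference cannot be integrated over
a half-line in `u`. Instead, Cauchy–Schwarz for the state bounds `|Im φ(E[R] D E[R'])|` by `‖D‖`
times `φ(R R*) + φ'(R'* R')`, which up to the factor `ε` is the sum of the two Poisson integrals
(`abs_im_le_of_cauchyTransform_sub_eq`). Such a relative bound integrates, as each Poisson integral
has total mass `π`. Thus the Cauchy-smoothed distribution functions differ by `O(n^{-1/2} ε⁻³)`;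
undoing the smoothing costs `O(√ε)`, and balancing the two errors yields `n^{-1/14}`. -/

noncomputable section

/-! ### Imaginary parts and inverses in a C*-algebra -/

section CStar

variable {A : Type*} [CStarAlgebra A]

lemma imaginaryPart_mul_I_eq (a : A) : (2 * Complex.I) • (ℑ a : A) = a - star a := by
  rw [imaginaryPart_apply_coe, ← Complex.coe_smul, smul_smul, smul_smul]
  have : 2 * Complex.I * (-Complex.I * ((2⁻¹ : ℝ) : ℂ)) = 1 := by
    push_cast
    linear_combination (-1 : ℂ) * Complex.I_sq
  rw [show 2 * Complex.I * -Complex.I * ((2⁻¹ : ℝ) : ℂ) = 1 by rw [← this]; ring, one_smul]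

lemma StarSubalgebra.inverse_mem {S : StarSubalgebra ℂ A} (hS : IsClosed (S : Set A)) {T : A}
    (hT : T ∈ S) (hu : IsUnit T) : Ring.inverse T ∈ S := by
  have := hS
  obtain ⟨v, hv⟩ := (StarSubalgebra.coe_isUnit (S := S) (a := ⟨T, hT⟩)).1 hu
  have h1 : T * ((v⁻¹ : Sˣ) : S) = 1 := by
    have := congrArg (Subtype.val) v.mul_inv
    rw [hv] at this
    simpa using this
  have h2 : Ring.inverse T = ((v⁻¹ : Sˣ) : S) := by
    have := congrArg (Ring.inverse T * ·) h1
    simp only [Ring.inverse_mul_cancel_left _ _ hu, mul_one] at this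
    exact this.symm
  rw [h2]
  exact ((v⁻¹ : Sˣ) : S).2

/-- Conjugating `T - T*` by `R = T⁻¹` gives `R* (T - T*) R = R* - R`. -/
lemma imaginaryPart_neg_inverse {T : A} (hT : IsUnit T) :
    (ℑ (-Ring.inverse T) : A) = star (Ring.inverse T) * (ℑ T : A) * Ring.inverse T := by
  set R := Ring.inverse T
  have h1 : T * R = 1 := Ring.mul_inverse_cancel _ hT
  have h2 : star R * star T = 1 := by rw [← star_mul, h1, star_one]
  have h3 : (2 * Complex.I) • (ℑ (-R) : A) =
      (2 * Complex.I) • (star R * (ℑ T : A) * R) := by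
    rw [← smul_mul_assoc, ← mul_smul_comm, imaginaryPart_mul_I_eq, imaginaryPart_mul_I_eq,
      mul_sub, h2, sub_mul, mul_assoc, h1]
    simp
    abel
  exact smul_right_injective A (show 2 * Complex.I ≠ 0 by simp) h3

end CStar

section ImaginaryPart

variable {A : Type*} [CStarAlgebra A] [PartialOrder A] [StarOrderedRing A]

lemma IsStrictlyPositive.one_le_norm_inverse_smul {h : A} (hh : IsStrictlyPositive h) :
    1 ≤ ‖Ring.inverse h‖ • h := by
  have hu : IsUnit (CFC.sqrt h) := hh.isUnit_cfcSqrt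
  have hsq : CFC.sqrt h * CFC.sqrt h = h := CFC.sqrt_mul_sqrt_self h hh.nonneg
  have h1 : Ring.inverse h ≤ algebraMap ℝ A ‖Ring.inverse h‖ :=
    hh.ringInverse.isSelfAdjoint.le_algebraMap_norm_self
  have h2 := conjugate_le_conjugate_of_nonneg h1 (CFC.sqrt_nonneg h)
  have h3 : CFC.sqrt h * Ring.inverse h * CFC.sqrt h = 1 := by
    have : Ring.inverse h = Ring.inverse (CFC.sqrt h) * Ring.inverse (CFC.sqrt h) := by
      conv_lhs => rw [← hsq]
      exact Ring.mul_inverse_rev' (Commute.refl _)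
    rw [this, ← mul_assoc, Ring.mul_inverse_cancel _ hu, one_mul, Ring.inverse_mul_cancel _ hu]
  rwa [h3, Algebra.algebraMap_eq_smul_one, mul_smul_comm, mul_one, smul_mul_assoc, hsq] at h2

lemma IsStrictlyPositive.of_one_le_smul {h : A} {s : ℝ} (hs : 0 < s) (hh : 1 ≤ s • h) :
    IsStrictlyPositive h := by
  have h1 : IsStrictlyPositive (s • h) := IsStrictlyPositive.of_le isStrictlyPositive_one hh
  have h2 : h = s⁻¹ • (s • h) := by rw [smul_smul, inv_mul_cancel₀ hs.ne', one_smul]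
  rw [h2]
  exact h1.smul (inv_pos.mpr hs)

/-- With `c = (Im T)^{1/2}` one has `T = c (S + i) c` for a self-adjoint `S`, and `-i` is not in the
real spectrum of `S`. -/
lemma isUnit_of_isStrictlyPositive_imaginaryPart {T : A}
    (hT : IsStrictlyPositive (ℑ T : A)) : IsUnit T := by
  set c := CFC.sqrt (ℑ T : A) with hc
  have hu : IsUnit c := hT.isUnit_cfcSqrt
  have hcs : IsSelfAdjoint c := (CFC.sqrt_nonneg _).isSelfAdjoint
  have hsq : c * c = (ℑ T : A) := CFC.sqrt_mul_sqrt_self _ hT.nonneg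
  set d := Ring.inverse c with hd
  have hds : IsSelfAdjoint d := by
    rw [IsSelfAdjoint, hd, ← Ring.inverse_star, hcs.star_eq]
  have hS : IsSelfAdjoint (d * (ℜ T : A) * d) := by
    have := (ℜ T).2.conjugate d
    rwa [hds.star_eq] at this
  have h1 : IsUnit (algebraMap ℂ A (-Complex.I) - d * (ℜ T : A) * d) := by
    by_contra hcon
    have hmem : (-Complex.I) ∈ spectrum ℂ (d * (ℜ T : A) * d) := hcon
    have := congrArg Complex.im (hS.mem_spectrum_eq_re hmem)
    simp at this
  have h2 : T = c * (-(algebraMap ℂ A (-Complex.I) - d * (ℜ T : A) * d)) * c := by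
    have h3 : c * (d * (ℜ T : A) * d) * c = (ℜ T : A) := by
      calc c * (d * (ℜ T : A) * d) * c = (c * d) * (ℜ T : A) * (d * c) := by noncomm_ring
        _ = _ := by rw [hd, Ring.mul_inverse_cancel _ hu, Ring.inverse_mul_cancel _ hu]; simp
    rw [neg_sub, mul_sub, sub_mul, h3, Algebra.algebraMap_eq_smul_one, mul_smul_comm, mul_one,
      smul_mul_assoc, hsq, neg_smul, sub_neg_eq_add, realPart_add_I_smul_imaginaryPart]
  rw [h2]
  exact (hu.mul h1.neg).mul hu

/-- Conjugating the hypothesis by `R = T⁻¹` gives `R* R ≤ s Im(-R)`, hence `‖R‖² ≤ s ‖R‖`. -/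
lemma norm_inverse_le_of_one_le_smul_imaginaryPart {T : A} (hT : IsUnit T) {s : ℝ} (hs : 0 ≤ s)
    (h : 1 ≤ s • (ℑ T : A)) : ‖Ring.inverse T‖ ≤ s := by
  set R := Ring.inverse T with hR
  have h1 := star_left_conjugate_le_conjugate h R
  rw [mul_one, mul_smul_comm, smul_mul_assoc, ← imaginaryPart_neg_inverse hT, ← hR] at h1
  have h2 : ‖R‖ * ‖R‖ ≤ s * ‖R‖ := by
    calc ‖R‖ * ‖R‖ = ‖star R * R‖ := CStarRing.norm_star_mul_self.symm
      _ ≤ ‖s • (ℑ (-R) : A)‖ := CStarAlgebra.norm_le_norm_of_nonneg_of_le (star_mul_self_nonneg R) h1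
      _ = s * ‖(ℑ (-R) : A)‖ := by rw [norm_smul, Real.norm_of_nonneg hs]
      _ ≤ s * ‖R‖ := by
        gcongr
        have := imaginaryPart.norm_le (-R)
        rw [norm_neg] at this
        exact this
  rcases (norm_nonneg R).eq_or_lt with h0 | h0
  · rw [← h0]; exact hs
  · exact le_of_mul_le_mul_right h2 h0

end ImaginaryPart

namespace OVCStarProbSpace

variable {A B : Type*} [CStarAlgebra A] [PartialOrder A] [StarOrderedRing A]
  [CStarAlgebra B] [PartialOrder B] [StarOrderedRing B] (P : OVCStarProbSpace A B)

/-! ### Cauchy–Schwarz and contractivity of the conditional expectation -/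

section Expectation

lemma E_star (a : A) : P.E (star a) = star (P.E a) := map_star P.E a

lemma E_nonneg {a : A} (ha : 0 ≤ a) : 0 ≤ P.E a := map_nonneg P.E ha

lemma E_mono {a a' : A} (h : a ≤ a') : P.E a ≤ P.E a' := OrderHomClass.mono P.E h

lemma E_one : P.E 1 = 1 := by simpa using P.E_incl 1

lemma E_incl_mul (b : B) (a : A) : P.E (P.incl b * a) = b * P.E a := by
  simpa using P.E_bimodule b 1 a

lemma E_mul_incl (a : A) (b : B) : P.E (a * P.incl b) = P.E a * b := by
  simpa using P.E_bimodule 1 b a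

lemma E_real_smul (r : ℝ) (a : A) : P.E (r • a) = r • P.E a := by
  rw [← Complex.coe_smul, map_smul, Complex.coe_smul]

lemma incl_real_smul (r : ℝ) (b : B) : P.incl (r • b) = r • P.incl b := by
  rw [← Complex.coe_smul, map_smul, Complex.coe_smul]

/-- Cauchy–Schwarz in the `B`-valued semi-inner product `⟨a, a'⟩ = E[a* a']`. -/
lemma star_E_mul_E_le {a a' : A} {N : ℝ} (hN : 0 < N) (h : ‖P.E (star a * a)‖ ≤ N) :
    star (P.E (star a * a')) * P.E (star a * a') ≤ N • P.E (star a' * a') := by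
  set c := P.E (star a * a') with hc
  have hcs : P.E (star a' * a) = star c := by rw [hc, ← P.E_star]; simp
  -- The usual minimizing vector of Cauchy–Schwarz, cleared of the denominator `N`.
  have h0 := P.E_nonneg (star_mul_self_nonneg (N • a' - a * P.incl c))
  have h1 : star (N • a' - a * P.incl c) * (N • a' - a * P.incl c) =
      (N * N) • (star a' * a') - N • (star a' * a * P.incl c) -
        N • (P.incl (star c) * (star a * a')) + P.incl (star c) * (star a * a) * P.incl c := by
    simp only [star_sub, star_smul, star_mul, star_trivial, sub_mul, mul_sub, smul_mul_assoc,
      mul_smul_comm, smul_sub, map_star, mul_assoc, smul_smul]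
    abel
  rw [h1, map_add, map_sub, map_sub, P.E_bimodule, P.E_real_smul, P.E_real_smul, P.E_real_smul,
    P.E_mul_incl, P.E_incl_mul, hcs, ← hc] at h0
  have h2 : P.E (star a * a) ≤ algebraMap ℝ B N :=
    (IsSelfAdjoint.of_nonneg (P.E_nonneg (star_mul_self_nonneg a))).le_algebraMap_norm_self.trans
      (algebraMap_mono B h)
  have h3 := star_left_conjugate_le_conjugate h2 c
  rw [Algebra.algebraMap_eq_smul_one, mul_smul_comm, mul_one, smul_mul_assoc] at h3
  have h4 : N • (star c * c) ≤ N • (N • P.E (star a' * a')) := by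
    rw [← sub_nonneg]
    refine (h0.trans (add_le_add_right h3 _)).trans_eq ?_
    rw [smul_smul]
    abel
  have h5 := smul_le_smul_of_nonneg_left h4 (inv_pos.mpr hN).le
  rwa [smul_smul, smul_smul, inv_mul_cancel₀ hN.ne', one_smul, one_smul] at h5

lemma norm_E_star_mul_sq_le (a a' : A) :
    ‖P.E (star a * a')‖ ^ 2 ≤ ‖P.E (star a * a)‖ * ‖P.E (star a' * a')‖ := by
  -- The norm may vanish, so a larger positive `N` is used and then decreased to it.
  have key : ∀ N : ℝ, ‖P.E (star a * a)‖ < N →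
      ‖P.E (star a * a')‖ ^ 2 ≤ N * ‖P.E (star a' * a')‖ := by
    intro N hN
    have hN0 : 0 < N := (norm_nonneg _).trans_lt hN
    have := CStarAlgebra.norm_le_norm_of_nonneg_of_le (star_mul_self_nonneg _)
      (P.star_E_mul_E_le (a' := a') hN0 hN.le)
    rwa [CStarRing.norm_star_mul_self, norm_smul, Real.norm_of_nonneg hN0.le, ← sq] at this
  refine ge_of_tendsto (x := nhdsWithin ‖P.E (star a * a)‖ (Set.Ioi _))
    (f := fun N => N * ‖P.E (star a' * a')‖) ?_ (eventually_nhdsWithin_of_forall key)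
  exact tendsto_nhdsWithin_of_tendsto_nhds ((continuous_id.mul continuous_const).tendsto _)

lemma norm_E_star_mul_le (a a' : A) :
    ‖P.E (star a * a')‖ ≤ √‖P.E (star a * a)‖ * √‖P.E (star a' * a')‖ := by
  rw [← Real.sqrt_mul (norm_nonneg _)]
  exact Real.le_sqrt_of_sq_le (P.norm_E_star_mul_sq_le a a')

lemma star_E_mul_E_self_le (a : A) : star (P.E a) * P.E a ≤ P.E (star a * a) := by
  have := P.star_E_mul_E_le (a := 1) (a' := a) one_pos (by
    rcases subsingleton_or_nontrivial B with h | h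
    · simp [Subsingleton.elim (P.E _) 0]
    · simp [P.E_one])
  simpa using this

lemma norm_E_le (a : A) : ‖P.E a‖ ≤ ‖a‖ := by
  have h1 := CStarAlgebra.norm_le_norm_of_nonneg_of_le (star_mul_self_nonneg _)
    (P.star_E_mul_E_self_le a)
  have h2 : P.E (star a * a) ≤ algebraMap ℝ B (‖a‖ ^ 2) := by
    have := P.E_mono (IsSelfAdjoint.star_mul_self a).le_algebraMap_norm_self
    rwa [Algebra.algebraMap_eq_smul_one, P.E_real_smul, P.E_one, CStarRing.norm_star_mul_self,
      ← sq, ← Algebra.algebraMap_eq_smul_one] at this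
  have h3 : ‖P.E (star a * a)‖ ≤ ‖a‖ ^ 2 :=
    (CStarAlgebra.norm_le_iff_le_algebraMap _ (sq_nonneg _)
      (P.E_nonneg (star_mul_self_nonneg a))).2 h2
  rw [CStarRing.norm_star_mul_self, ← sq] at h1
  exact (sq_le_sq₀ (norm_nonneg _) (norm_nonneg _)).1 (h1.trans h3)

lemma continuous_E : Continuous P.E :=
  AddMonoidHomClass.continuous_of_bound P.E 1 (by simpa using P.norm_E_le)

lemma norm_incl (b : B) : ‖P.incl b‖ = ‖b‖ :=
  NonUnitalStarAlgHom.norm_map P.incl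
    (fun b b' h => by rw [← P.E_incl b, h, P.E_incl]) b

end Expectation

/-! ### Resolvents and Cauchy transforms on the operator upper half-plane -/

section HalfPlane

lemma isUnit_of_mem {b : B} (hb : b ∈ opUpperHalfPlane B) : IsUnit b :=
  isUnit_of_isStrictlyPositive_imaginaryPart hb

lemma imaginaryPart_incl_sub (b : B) {x : A} (hx : IsSelfAdjoint x) :
    (ℑ (P.incl b - x) : A) = P.incl (ℑ b : B) := by
  rw [map_sub, hx.imaginaryPart, sub_zero, map_imaginaryPart]

lemma one_le_smul_imaginaryPart {b : B} (hb : b ∈ opUpperHalfPlane B) {x : A}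
    (hx : IsSelfAdjoint x) : 1 ≤ ‖Ring.inverse (ℑ b : B)‖ • (ℑ (P.incl b - x) : A) := by
  have h := OrderHomClass.mono P.incl (IsStrictlyPositive.one_le_norm_inverse_smul hb)
  rwa [map_one, P.incl_real_smul, ← P.imaginaryPart_incl_sub b hx] at h

lemma isStrictlyPositive_imaginaryPart_incl_sub {b : B} (hb : b ∈ opUpperHalfPlane B) {x : A}
    (hx : IsSelfAdjoint x) : IsStrictlyPositive (ℑ (P.incl b - x) : A) := by
  rw [P.imaginaryPart_incl_sub b hx]
  exact ⟨map_nonneg P.incl (IsStrictlyPositive.nonneg hb),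
    (IsStrictlyPositive.isUnit hb).map P.incl⟩

lemma isUnit_incl_sub {b : B} (hb : b ∈ opUpperHalfPlane B) {x : A} (hx : IsSelfAdjoint x) :
    IsUnit (P.incl b - x) :=
  isUnit_of_isStrictlyPositive_imaginaryPart (P.isStrictlyPositive_imaginaryPart_incl_sub hb hx)

lemma norm_resolvent_le {b : B} (hb : b ∈ opUpperHalfPlane B) {x : A} (hx : IsSelfAdjoint x) :
    ‖Ring.inverse (P.incl b - x)‖ ≤ ‖Ring.inverse (ℑ b : B)‖ :=
  norm_inverse_le_of_one_le_smul_imaginaryPart (P.isUnit_incl_sub hb hx) (norm_nonneg _)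
    (P.one_le_smul_imaginaryPart hb hx)

lemma norm_inverse_le {b : B} (hb : b ∈ opUpperHalfPlane B) :
    ‖Ring.inverse b‖ ≤ ‖Ring.inverse (ℑ b : B)‖ :=
  norm_inverse_le_of_one_le_smul_imaginaryPart (isUnit_of_mem hb) (norm_nonneg _)
    (IsStrictlyPositive.one_le_norm_inverse_smul hb)

lemma norm_cauchyTransform_le {b : B} (hb : b ∈ opUpperHalfPlane B) {x : A}
    (hx : IsSelfAdjoint x) : ‖P.cauchyTransform x b‖ ≤ ‖Ring.inverse (ℑ b : B)‖ :=
  (P.norm_E_le _).trans (P.norm_resolvent_le hb hx)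

lemma isStrictlyPositive_E {a : A} (ha : IsStrictlyPositive a) : IsStrictlyPositive (P.E a) := by
  set s := ‖Ring.inverse a‖ + 1
  have hs : 0 < s := by positivity
  have h1 : 1 ≤ s • a := ha.one_le_norm_inverse_smul.trans
    (smul_le_smul_of_nonneg_right (by simp [s]) ha.nonneg)
  have h2 := P.E_mono h1
  rw [P.E_one, P.E_real_smul] at h2
  exact .of_one_le_smul hs h2

/-- The negative of the resolvent has strictly positive imaginary part, and `E` preserves strict
positivity. -/
lemma isUnit_cauchyTransform {b : B} (hb : b ∈ opUpperHalfPlane B) {x : A}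
    (hx : IsSelfAdjoint x) : IsUnit (P.cauchyTransform x b) := by
  have hu := P.isUnit_incl_sub hb hx
  have h1 : IsStrictlyPositive (ℑ (-Ring.inverse (P.incl b - x)) : A) := by
    rw [imaginaryPart_neg_inverse hu]
    exact hu.ringInverse.isStrictlyPositive_star_left_conjugate_iff.2
      (P.isStrictlyPositive_imaginaryPart_incl_sub hb hx)
  have h2 := P.isStrictlyPositive_E h1
  rw [map_imaginaryPart] at h2
  have h3 := isUnit_of_isStrictlyPositive_imaginaryPart h2
  rw [map_neg] at h3
  simpa [cauchyTransform] using h3.neg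

end HalfPlane

/-! ### C*-subalgebras generated over `B`, and induction by density -/

section Generated

/-- The C*-subalgebra of `A` generated by `B` and a set `s`. -/
def generated (s : Set A) : StarSubalgebra ℂ A :=
  (StarAlgebra.adjoin ℂ (Set.range P.incl ∪ s)).topologicalClosure

lemma isClosed_generated (s : Set A) : IsClosed (P.generated s : Set A) :=
  StarSubalgebra.isClosed_topologicalClosure _

lemma incl_mem_generated (s : Set A) (b : B) : P.incl b ∈ P.generated s :=
  StarSubalgebra.le_topologicalClosure _ (StarAlgebra.subset_adjoin _ _ (.inl ⟨b, rfl⟩))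

lemma mem_generated {s : Set A} {a : A} (ha : a ∈ s) : a ∈ P.generated s :=
  StarSubalgebra.le_topologicalClosure _ (StarAlgebra.subset_adjoin _ _ (.inr ha))

lemma generated_induction {s : Set A} (hs : ∀ a ∈ s, IsSelfAdjoint a) {p : A → Prop}
    (hp : IsClosed {a | p a}) (h : ∀ a ∈ Algebra.adjoin ℂ (Set.range P.incl ∪ s), p a)
    {a : A} (ha : a ∈ P.generated s) : p a := by
  have hsub : ((StarAlgebra.adjoin ℂ (Set.range P.incl ∪ s) : StarSubalgebra ℂ A) : Set A) ⊆
      {a | p a} := by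
    intro a ha
    refine h a ?_
    have hstar : star (Set.range P.incl ∪ s) = Set.range P.incl ∪ s := by
      have h1 : star (Set.range P.incl ∪ s) ⊆ Set.range P.incl ∪ s := by
        rintro c (⟨b, hb⟩ | hc)
        · exact .inl ⟨star b, by rw [map_star, hb, star_star]⟩
        · have := hs _ hc
          rw [IsSelfAdjoint, star_star] at this
          exact .inr (this ▸ hc)
      refine h1.antisymm fun c hc => ?_
      have : star (star c) ∈ Set.range P.incl ∪ s := by rwa [star_star]
      exact h1 this
    have h2 : a ∈ (StarAlgebra.adjoin ℂ (Set.range P.incl ∪ s)).toSubalgebra := ha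
    rwa [StarAlgebra.adjoin_toSubalgebra, hstar, Set.union_self] at h2
  exact closure_minimal hsub hp ha

lemma resolvent_mem_generated {s : Set A} {b : B} (hb : b ∈ opUpperHalfPlane B) {x : A}
    (hx : IsSelfAdjoint x) (hxs : x ∈ P.generated s) :
    Ring.inverse (P.incl b - x) ∈ P.generated s :=
  StarSubalgebra.inverse_mem (P.isClosed_generated s)
    (sub_mem (P.incl_mem_generated s b) hxs) (P.isUnit_incl_sub hb hx)

end Generated

/-! ### Factorization under Boolean independence -/

section Boolean

lemma mul_mem_bimoduleAlgebra (x : A) (b b' : B) : P.incl b * x * P.incl b' ∈ P.bimoduleAlgebra x :=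
  NonUnitalAlgebra.subset_adjoin ℂ ⟨b, b', rfl⟩

lemma incl_mul_mem_bimoduleAlgebra {x a : A} (b : B) (ha : a ∈ P.bimoduleAlgebra x) :
    P.incl b * a ∈ P.bimoduleAlgebra x := by
  induction ha using NonUnitalAlgebra.adjoin_induction with
  | mem a ha =>
    obtain ⟨b₁, b₂, rfl⟩ := ha
    simpa [mul_assoc] using P.mul_mem_bimoduleAlgebra x (b * b₁) b₂
  | add a a' _ _ h h' => rw [mul_add]; exact add_mem h h'
  | zero => rw [mul_zero]; exact zero_mem _
  | mul a a' _ ha' h _ => rw [← mul_assoc]; exact mul_mem h ha'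
  | smul r a _ h => rw [mul_smul_comm]; exact SMulMemClass.smul_mem r h

lemma mul_incl_mem_bimoduleAlgebra {x a : A} (b : B) (ha : a ∈ P.bimoduleAlgebra x) :
    a * P.incl b ∈ P.bimoduleAlgebra x := by
  induction ha using NonUnitalAlgebra.adjoin_induction with
  | mem a ha =>
    obtain ⟨b₁, b₂, rfl⟩ := ha
    simpa [mul_assoc] using P.mul_mem_bimoduleAlgebra x b₁ (b₂ * b)
  | add a a' _ _ h h' => rw [add_mul]; exact add_mem h h'
  | zero => rw [zero_mul]; exact zero_mem _
  | mul a a' ha _ _ h' => rw [mul_assoc]; exact mul_mem ha h'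
  | smul r a _ h => rw [smul_mul_assoc]; exact SMulMemClass.smul_mem r h

lemma exists_eq_incl_add_of_mem_adjoin {x v : A}
    (hv : v ∈ Algebra.adjoin ℂ (Set.range P.incl ∪ {x})) :
    ∃ b : B, ∃ a ∈ P.bimoduleAlgebra x, v = P.incl b + a := by
  induction hv using Algebra.adjoin_induction with
  | mem v hv =>
    rcases hv with ⟨b, rfl⟩ | rfl
    · exact ⟨b, 0, zero_mem _, by simp⟩
    · exact ⟨0, v, by simpa using P.mul_mem_bimoduleAlgebra v 1 1, by simp⟩
  | algebraMap r => exact ⟨algebraMap ℂ B r, 0, zero_mem _, by rw [AlgHomClass.commutes, add_zero]⟩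
  | add v v' _ _ h h' =>
    obtain ⟨b, a, ha, rfl⟩ := h
    obtain ⟨b', a', ha', rfl⟩ := h'
    exact ⟨b + b', a + a', add_mem ha ha', by rw [map_add]; abel⟩
  | mul v v' _ _ h h' =>
    obtain ⟨b, a, ha, rfl⟩ := h
    obtain ⟨b', a', ha', rfl⟩ := h'
    exact ⟨b * b', P.incl b * a' + a * P.incl b' + a * a',
      add_mem (add_mem (P.incl_mul_mem_bimoduleAlgebra b ha')
        (P.mul_incl_mem_bimoduleAlgebra b' ha)) (mul_mem ha ha'),
      by rw [map_mul]; noncomm_ring⟩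

variable {I : Type*} (x : I → A)

/-- `a` is a product of elements of the algebras generated by the `x k`, with distinct neighbouring
indices, the last of them being `i`. -/
def IsAlternating (i : I) (a : A) : Prop :=
  ∃ l : List (I × A), (l.map Prod.fst).IsChain (· ≠ ·) ∧
    (∀ p ∈ l, p.2 ∈ P.bimoduleAlgebra (x p.1)) ∧ (l.map Prod.fst).getLast? = some i ∧
    a = (l.map Prod.snd).prod

lemma isAlternating_self (i : I) : P.IsAlternating x i (x i) :=
  ⟨[(i, x i)], by simp, by simpa using P.mul_mem_bimoduleAlgebra (x i) 1 1, by simp, by simp⟩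

variable {x}

/-- The new letter is absorbed into the first factor if the indices agree, and otherwise starts a
new factor. The last index never changes. -/
lemma IsAlternating.mul_left {i : I} {a : A} (ha : P.IsAlternating x i a) (j : I) (b : B) :
    P.IsAlternating x i (x j * P.incl b * a) := by
  obtain ⟨l, hl, hm, hlast, rfl⟩ := ha
  have hj : x j * P.incl b ∈ P.bimoduleAlgebra (x j) := by
    simpa using P.mul_mem_bimoduleAlgebra (x j) 1 b
  rcases l with _ | ⟨⟨k, c⟩, t⟩
  · simp at hlast
  by_cases hjk : j = k
  · subst hjk
    refine ⟨(j, x j * P.incl b * c) :: t, hl, ?_, hlast, by simp [mul_assoc]⟩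
    intro p hp
    rcases List.mem_cons.1 hp with rfl | hp
    · exact mul_mem hj (hm _ (List.mem_cons_self ..))
    · exact hm _ (List.mem_cons_of_mem _ hp)
  · refine ⟨(j, x j * P.incl b) :: (k, c) :: t, ?_, ?_, by simpa using hlast, by simp⟩
    · simpa [hjk] using hl
    · intro p hp
      rcases List.mem_cons.1 hp with rfl | hp
      · exact hj
      · exact hm _ hp

lemma BooleanIndep.E_mul_of_isAlternating (h : P.BooleanIndep x) {i j : I} (hij : i ≠ j) {a v : A}
    (ha : P.IsAlternating x i a) (hv : v ∈ P.bimoduleAlgebra (x j)) :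
    P.E (a * v) = P.E a * P.E v := by
  obtain ⟨l, hl, hm, hlast, rfl⟩ := ha
  have h1 := h l (by simpa [List.isChain_map] using hl) hm
  have h2 := h (l ++ [(j, v)]) (by
    rw [← List.isChain_map (R := (· ≠ ·)) Prod.fst, List.map_append]
    refine List.isChain_append.2 ⟨hl, by simp, ?_⟩
    intro p hp q hq
    rw [hlast] at hp
    simp at hp hq
    rw [← hp, ← hq]
    exact hij) (by
    intro p hp
    rcases List.mem_append.1 hp with hp | hp
    · exact hm p hp
    · rw [List.mem_singleton.1 hp]; exact hv)
  simp only [List.map_append, List.prod_append, List.map_cons, List.map_nil, List.prod_singleton]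
    at h2
  rw [h1, ← h2]

lemma mul_mem_span_isAlternating {w : A} (i : I)
    (hw : w ∈ Algebra.adjoin ℂ (Set.range P.incl ∪ Set.range x)) :
    ∀ m ∈ Submodule.span ℂ {m | ∃ b : B, ∃ a, P.IsAlternating x i a ∧ m = P.incl b * a},
      w * m ∈ Submodule.span ℂ {m | ∃ b : B, ∃ a, P.IsAlternating x i a ∧ m = P.incl b * a} := by
  induction hw using Algebra.adjoin_induction with
  | mem w hw =>
    intro m hm
    induction hm using Submodule.span_induction with
    | zero => rw [mul_zero]; exact zero_mem _
    | add m m' _ _ h h' => rw [mul_add]; exact add_mem h h'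
    | smul r m _ h => rw [mul_smul_comm]; exact Submodule.smul_mem _ r h
    | mem m hm =>
      obtain ⟨b, a, ha, rfl⟩ := hm
      refine Submodule.subset_span ?_
      rcases hw with ⟨b', rfl⟩ | ⟨j, rfl⟩
      · exact ⟨b' * b, a, ha, by rw [map_mul, mul_assoc]⟩
      · exact ⟨1, _, ha.mul_left P j b, by rw [map_one, one_mul, mul_assoc]⟩
  | algebraMap r =>
    intro m hm
    rw [← Algebra.smul_def]
    exact Submodule.smul_mem _ r hm
  | add w w' _ _ h h' => intro m hm; rw [add_mul]; exact add_mem (h m hm) (h' m hm)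
  | mul w w' _ _ h h' => intro m hm; rw [mul_assoc]; exact h _ (h' m hm)

/-- Algebraically, `w * x i` is a combination of words ending with index `i`, to which a factor of
index `j ≠ i` may be appended. Continuity of `E` extends this to the closures, where the resolvents
live. -/
lemma BooleanIndep.E_mul_mul (h : P.BooleanIndep x) (hx : ∀ i, IsSelfAdjoint (x i)) {i j : I}
    (hij : i ≠ j) {w v : A} (hw : w ∈ P.generated (Set.range x)) (hv : v ∈ P.generated {x j}) :
    P.E (w * x i * v) = P.E (w * x i) * P.E v := by
  have hE := P.continuous_E
  refine P.generated_induction (s := {x j}) (by rintro a rfl; exact hx j)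
    (p := fun v => P.E (w * x i * v) = P.E (w * x i) * P.E v)
    (isClosed_eq (by fun_prop) (by fun_prop)) ?_ hv
  intro v hv
  obtain ⟨b, a, ha, rfl⟩ := P.exists_eq_incl_add_of_mem_adjoin hv
  -- The component of `v` in `B` factors out by the bimodule property alone.
  suffices P.E (w * x i * a) = P.E (w * x i) * P.E a by
    rw [mul_add, map_add, map_add, P.E_mul_incl, P.E_incl, this, mul_add]
  refine P.generated_induction (s := Set.range x) (by rintro a ⟨k, rfl⟩; exact hx k)
    (p := fun w => P.E (w * x i * a) = P.E (w * x i) * P.E a)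
    (isClosed_eq (by fun_prop) (by fun_prop)) ?_ hw
  intro w hw
  have hmem := P.mul_mem_span_isAlternating i hw (x i)
    (Submodule.subset_span ⟨1, x i, P.isAlternating_self x i, by simp⟩)
  revert hmem
  generalize w * x i = m
  intro hm
  induction hm using Submodule.span_induction with
  | zero => simp
  | add m m' _ _ h h' => rw [add_mul, map_add, map_add, h, h', add_mul]
  | smul r m _ h => rw [smul_mul_assoc, map_smul, map_smul, h, smul_mul_assoc]
  | mem m hm =>
    obtain ⟨b, c, hc, rfl⟩ := hm
    rw [mul_assoc, P.E_incl_mul, P.E_incl_mul, h.E_mul_of_isAlternating P hij hc ha, mul_assoc]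

end Boolean

/-! ### The self-energy of one summand and its second-order approximation -/

section Cumulant

/-- The equation `(b - y) u = y - β` has a centered solution `u` with `β = E[y u] ∈ B`. -/
lemma exists_centered_solution {b : B} (hb : b ∈ opUpperHalfPlane B) {y : A}
    (hy : IsSelfAdjoint y) {s : Set A} (hys : y ∈ P.generated s) :
    ∃ u ∈ P.generated s, P.E u = 0 ∧ ∃ β : B, (P.incl b - y) * u = y - P.incl β := by
  set R := Ring.inverse (P.incl b - y) with hR
  have hRs : R ∈ P.generated s := P.resolvent_mem_generated hb hy hys
  -- For `u = R (y - β)`, the condition `E[u] = 0` reads `E[R] β = E[R y]`.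
  set β := Ring.inverse (P.E R) * P.E (R * y) with hβ
  refine ⟨R * y - R * P.incl β,
    sub_mem (mul_mem hRs hys) (mul_mem hRs (P.incl_mem_generated s β)), ?_, β, ?_⟩
  · rw [map_sub, P.E_mul_incl, hβ,
      Ring.mul_inverse_cancel_left (P.E R) _ (P.isUnit_cauchyTransform hb hy), sub_self]
  · rw [← mul_sub, hR, Ring.mul_inverse_cancel_left _ _ (P.isUnit_incl_sub hb hy)]

variable {P} in
lemma eq_E_mul_of_centered_solution {b β : B} {y u : A} (hy : P.E y = 0) (hu : P.E u = 0)
    (h : (P.incl b - y) * u = y - P.incl β) : β = P.E (y * u) := by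
  have := congrArg P.E h
  rw [sub_mul, map_sub, P.E_incl_mul, hu, map_sub, P.E_incl, hy, mul_zero, zero_sub, zero_sub]
    at this
  exact (neg_injective this).symm

variable {P} in
-- Energy estimate: pairing the equation with `u` removes `β`, because `E[u*] β = 0`. Imaginary
-- parts then give `E[u* u] ≤ s Im E[u* y]`, and Cauchy–Schwarz allows one factor to be cancelled.
lemma sqrt_norm_E_star_mul_self_le_of_centered_solution {b β : B} (hb : b ∈ opUpperHalfPlane B)
    {y u : A} (hy : IsSelfAdjoint y) (hu : P.E u = 0) (h : (P.incl b - y) * u = y - P.incl β) :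
    √‖P.E (star u * u)‖ ≤ ‖Ring.inverse (ℑ b : B)‖ * √‖P.E (y ^ 2)‖ := by
  set s := ‖Ring.inverse (ℑ b : B)‖ with hs
  have h1 := P.E_mono (star_left_conjugate_le_conjugate (P.one_le_smul_imaginaryPart hb hy) u)
  rw [mul_one, mul_smul_comm, smul_mul_assoc, P.E_real_smul, ← hs] at h1
  have h2 : P.E (star u * (P.incl b - y) * u) = P.E (star u * y) := by
    rw [mul_assoc, h, mul_sub, map_sub, P.E_mul_incl, P.E_star, hu, star_zero, zero_mul, sub_zero]
  have h3 : P.E (star u * (ℑ (P.incl b - y) : A) * u) = (ℑ (P.E (star u * y)) : B) := by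
    have h4 : (2 * Complex.I) • P.E (star u * (ℑ (P.incl b - y) : A) * u) =
        (2 * Complex.I) • (ℑ (P.E (star u * y)) : B) := by
      rw [imaginaryPart_mul_I_eq, ← map_smul, ← smul_mul_assoc, ← mul_smul_comm,
        imaginaryPart_mul_I_eq, ← h2, ← P.E_star, mul_sub, sub_mul, map_sub]
      congr 2
      simp [mul_assoc]
    exact smul_right_injective B (show 2 * Complex.I ≠ 0 by simp) h4
  rw [h3] at h1
  have h5 : ‖P.E (star u * u)‖ ≤ s * (√‖P.E (star u * u)‖ * √‖P.E (y ^ 2)‖) := by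
    calc ‖P.E (star u * u)‖ ≤ ‖s • (ℑ (P.E (star u * y)) : B)‖ :=
          CStarAlgebra.norm_le_norm_of_nonneg_of_le (P.E_nonneg (star_mul_self_nonneg u)) h1
      _ = s * ‖(ℑ (P.E (star u * y)) : B)‖ := by
          rw [norm_smul, Real.norm_of_nonneg (norm_nonneg _)]
      _ ≤ s * ‖P.E (star u * y)‖ := by
          gcongr
          exact imaginaryPart.norm_le (P.E (star u * y))
      _ ≤ _ := by
          gcongr
          have := P.norm_E_star_mul_le u y
          rwa [hy.star_eq, ← sq] at this
  rcases (Real.sqrt_nonneg ‖P.E (star u * u)‖).eq_or_lt with h0 | h0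
  · rw [← h0]; positivity
  · refine le_of_mul_le_mul_left ?_ h0
    rw [Real.mul_self_sqrt (norm_nonneg _)]
    linarith

variable {P} in
-- Substituting `u = g y u + g y - g β` into `β = E[y u]` leaves the remainder `E[y g y u]`, as
-- `E[y] = 0`. Cauchy–Schwarz splits it into a fourth-order moment and the energy of `u`.
lemma norm_sub_E_le_of_centered_solution {b β : B} (hb : b ∈ opUpperHalfPlane B) {y u : A}
    (hy : IsSelfAdjoint y) (hy0 : P.E y = 0) (hu : P.E u = 0)
    (h : (P.incl b - y) * u = y - P.incl β) :
    ‖β - P.E (y * P.incl (Ring.inverse b) * y)‖ ≤ ‖Ring.inverse (ℑ b : B)‖ * √‖P.E (y ^ 2)‖ *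
      √‖P.E (y * P.incl (Ring.inverse b) * y ^ 2 * P.incl (star (Ring.inverse b)) * y)‖ := by
  set g := Ring.inverse b with hg
  have hgb : P.incl g * P.incl b = 1 := by
    rw [← map_mul, hg, Ring.inverse_mul_cancel _ (isUnit_of_mem hb), map_one]
  have hgs : star (P.incl (star g)) = P.incl g := by rw [← map_star, star_star]
  have h1 : u = P.incl g * y * u + P.incl g * y - P.incl (g * β) := by
    have := congrArg (P.incl g * ·) h
    simp only [sub_mul, mul_sub, ← mul_assoc, hgb, one_mul] at this
    rw [map_mul]
    rw [sub_eq_iff_eq_add] at this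
    nth_rw 1 [this]
    abel
  have h2 : β - P.E (y * P.incl g * y) = P.E (star (y * P.incl (star g) * y) * u) := by
    rw [eq_E_mul_of_centered_solution hy0 hu h]
    nth_rw 1 [h1]
    rw [mul_sub, mul_add, map_sub, map_add, P.E_mul_incl, hy0, zero_mul, sub_zero]
    simp [hy.star_eq, hgs, mul_assoc]
  rw [h2]
  refine (P.norm_E_star_mul_le _ _).trans ?_
  rw [mul_comm]
  have h3 : star (y * P.incl (star g) * y) * (y * P.incl (star g) * y) =
      y * P.incl g * y ^ 2 * P.incl (star g) * y := by
    simp [hy.star_eq, hgs, mul_assoc, sq]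
  rw [h3]
  gcongr
  exact sqrt_norm_E_star_mul_self_le_of_centered_solution hb hy hu h

end Cumulant

/-! ### Additivity of the self-energies -/

section Sum

variable {P} {I : Type*} [Fintype I] {x : I → A}

lemma BooleanIndep.cauchyTransform_sum_mul (h : P.BooleanIndep x) (hx : ∀ i, IsSelfAdjoint (x i))
    {b : B} (hb : b ∈ opUpperHalfPlane B) (r : ℝ) {u : I → A} {β : I → B}
    (hmem : ∀ i, u i ∈ P.generated {x i}) (hu : ∀ i, P.E (u i) = 0)
    (hβ : ∀ i, (P.incl b - r • x i) * u i = r • x i - P.incl (β i)) :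
    P.cauchyTransform (r • ∑ i, x i) b * (b - ∑ i, β i) = 1 := by
  classical
  set X := r • ∑ i, x i with hX
  have hXs : IsSelfAdjoint X := (IsSelfAdjoint.all r).smul (isSelfAdjoint_sum _ fun i _ => hx i)
  set R := Ring.inverse (P.incl b - X) with hR
  have hXmem : X ∈ P.generated (Set.range x) := by
    rw [hX, ← Complex.coe_smul]
    exact SMulMemClass.smul_mem _ (sum_mem fun i _ => P.mem_generated ⟨i, rfl⟩)
  have hRmem : R ∈ P.generated (Set.range x) := P.resolvent_mem_generated hb hXs hXmem
  have hunit := P.isUnit_incl_sub hb hXs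
  -- The diagonal terms `r x_j u_j` are absorbed by the equation for `u_j`, so only pairs `i ≠ j`
  -- remain.
  have h1 : (P.incl b - X) * (1 + ∑ j, u j) =
      P.incl (b - ∑ i, β i) - r • ∑ j, ∑ i ∈ Finset.univ.erase j, x i * u j := by
    have h2 : ∀ j, X * u j = r • x j * u j + r • ∑ i ∈ Finset.univ.erase j, x i * u j := by
      intro j
      rw [hX, smul_mul_assoc, smul_mul_assoc, Finset.sum_mul, ← smul_add,
        Finset.add_sum_erase _ (fun i => x i * u j) (Finset.mem_univ j)]
    have h3 : ∀ j, P.incl b * u j = r • x j - P.incl (β j) + r • x j * u j := by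
      intro j
      rw [← hβ j, sub_mul]
      abel
    rw [mul_add, mul_one, Finset.mul_sum]
    simp_rw [sub_mul, h2, h3, Finset.sum_sub_distrib, Finset.sum_add_distrib,
      Finset.sum_sub_distrib, ← Finset.smul_sum]
    rw [map_sub, map_sum]
    abel
  have h4 : ∀ j, ∀ i ∈ Finset.univ.erase j, P.E (R * (x i * u j)) = 0 := by
    intro j i hi
    rw [← mul_assoc, h.E_mul_mul P hx (Finset.ne_of_mem_erase hi) hRmem (hmem j), hu, mul_zero]
  have h5 := congrArg (fun a => P.E (R * a)) h1
  rw [hR, Ring.inverse_mul_cancel_left _ _ hunit, ← hR, mul_sub, map_sub, P.E_mul_incl,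
    mul_smul_comm, P.E_real_smul, Finset.mul_sum, map_sum] at h5
  simp_rw [Finset.mul_sum, map_sum] at h5
  rw [Finset.sum_eq_zero fun j _ => Finset.sum_eq_zero (h4 j), smul_zero, sub_zero, map_add,
    P.E_one, map_sum, Finset.sum_eq_zero fun j _ => hu j, add_zero] at h5
  exact h5.symm

end Sum

/-! ### The Cauchy transform of a Bernoulli element -/

section Bernoulli

variable {P} {η : B → B} {x : A}

lemma IsBernoulli.E_mul_list (h : P.IsBernoulli η x) (g b₀ : B) (l : List B) :
    P.E (x * P.incl g * x * (P.incl b₀ * (l.map fun b => x * P.incl b).prod)) =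
      η g * P.E (P.incl b₀ * (l.map fun b => x * P.incl b).prod) := by
  have h1 := h.2 1 (g :: b₀ :: l)
  rw [map_one, one_mul, one_mul] at h1
  rw [h.2 b₀ l, ← mul_assoc]
  simpa only [List.map_cons, List.prod_cons, bernoulliMoment, mul_assoc] using h1

lemma mul_mem_span_words {w : A} (hw : w ∈ Algebra.adjoin ℂ (Set.range P.incl ∪ {x})) :
    ∀ m ∈ Submodule.span ℂ
        {m | ∃ (b₀ : B) (l : List B), m = P.incl b₀ * (l.map fun b => x * P.incl b).prod},
      w * m ∈ Submodule.span ℂ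
        {m | ∃ (b₀ : B) (l : List B), m = P.incl b₀ * (l.map fun b => x * P.incl b).prod} := by
  induction hw using Algebra.adjoin_induction with
  | mem w hw =>
    intro m hm
    induction hm using Submodule.span_induction with
    | zero => rw [mul_zero]; exact zero_mem _
    | add m m' _ _ h h' => rw [mul_add]; exact add_mem h h'
    | smul r m _ h => rw [mul_smul_comm]; exact Submodule.smul_mem _ r h
    | mem m hm =>
      obtain ⟨b₀, l, rfl⟩ := hm
      refine Submodule.subset_span ?_
      rcases hw with ⟨b', rfl⟩ | rfl
      · exact ⟨b' * b₀, l, by rw [map_mul, mul_assoc]⟩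
      · exact ⟨1, b₀ :: l, by simp [mul_assoc]⟩
  | algebraMap r =>
    intro m hm
    rw [← Algebra.smul_def]
    exact Submodule.smul_mem _ r hm
  | add w w' _ _ h h' => intro m hm; rw [add_mul]; exact add_mem (h m hm) (h' m hm)
  | mul w w' _ _ h h' => intro m hm; rw [mul_assoc]; exact h _ (h' m hm)

/-- The moment formula peels off the first two letters of a word; linearity and density give the
rest. -/
lemma IsBernoulli.E_mul (h : P.IsBernoulli η x) (hx : IsSelfAdjoint x) (g : B) {w : A}
    (hw : w ∈ P.generated {x}) : P.E (x * P.incl g * x * w) = η g * P.E w := by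
  have hE := P.continuous_E
  refine P.generated_induction (s := {x}) (by rintro a rfl; exact hx)
    (p := fun w => P.E (x * P.incl g * x * w) = η g * P.E w)
    (isClosed_eq (by fun_prop) (by fun_prop)) ?_ hw
  intro w hw
  have hmem := mul_mem_span_words hw 1 (Submodule.subset_span ⟨1, [], by simp⟩)
  rw [mul_one] at hmem
  clear hw
  induction hmem using Submodule.span_induction with
  | zero => simp
  | add m m' _ _ h h' => rw [mul_add, map_add, map_add, h, h', mul_add]
  | smul r m _ h => rw [mul_smul_comm, map_smul, map_smul, h, mul_smul_comm]
  | mem m hm =>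
    obtain ⟨b₀, l, rfl⟩ := hm
    exact h.E_mul_list g b₀ l

lemma IsBernoulli.mul_cauchyTransform (h : P.IsBernoulli η x) (hx : IsSelfAdjoint x)
    {b : B} (hb : b ∈ opUpperHalfPlane B) :
    (b - η (Ring.inverse b)) * P.cauchyTransform x b = 1 := by
  set g := Ring.inverse b with hg
  set R := Ring.inverse (P.incl b - x) with hR
  have hgb : P.incl g * P.incl b = 1 := by
    rw [← map_mul, hg, Ring.inverse_mul_cancel _ (isUnit_of_mem hb), map_one]
  have hRmem : R ∈ P.generated {x} := P.resolvent_mem_generated hb hx (P.mem_generated rfl)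
  -- Multiplied on the right by the resolvent, this leaves only terms that `E_mul` and `E[x] = 0`
  -- evaluate.
  have h1 : (1 + x * P.incl g) * (P.incl b - x) = P.incl b - x * P.incl g * x := by
    rw [add_mul, one_mul, mul_sub, mul_assoc x, hgb, mul_one]
    abel
  have h2 := congrArg (fun a => P.E (a * R)) h1
  rw [hR, Ring.mul_inverse_cancel_right _ _ (P.isUnit_incl_sub hb hx), ← hR, sub_mul, map_sub,
    P.E_incl_mul, h.E_mul hx g hRmem, map_add, P.E_one, P.E_mul_incl, h.1, zero_mul, add_zero,
    ← sub_mul] at h2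
  exact h2.symm

end Bernoulli

/-! ### Comparison of the two Cauchy transforms -/

section Comparison

variable {P} {A' : Type*} [CStarAlgebra A'] [PartialOrder A'] [StarOrderedRing A']
  {P' : OVCStarProbSpace A' B} {n : ℕ} {x : Fin n → A} {y : A'}

lemma norm_E_sq_le_alpha₂ (P : OVCStarProbSpace A B) (x : Fin n → A) (i : Fin n) :
    ‖P.E (x i ^ 2)‖ ≤ P.alpha₂ x :=
  le_ciSup (f := fun i => ‖P.E (x i ^ 2)‖) (Set.finite_range _).bddAbove i

lemma norm_E_pow_four_le_alphaTilde₄ (P : OVCStarProbSpace A B) (x : Fin n → A) (i : Fin n) :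
    ‖P.E (x i ^ 4)‖ ≤ P.alphaTilde₄ x :=
  le_ciSup (f := fun i => ‖P.E (x i ^ 4)‖) (Set.finite_range _).bddAbove i

lemma alpha₂_nonneg (P : OVCStarProbSpace A B) (x : Fin n → A) : 0 ≤ P.alpha₂ x :=
  Real.iSup_nonneg fun _ => norm_nonneg _

lemma alphaTilde₄_nonneg (P : OVCStarProbSpace A B) (x : Fin n → A) : 0 ≤ P.alphaTilde₄ x :=
  Real.iSup_nonneg fun _ => norm_nonneg _

/-- Homogeneity in `b`. The real supremum is an upper bound only because the family is bounded, by
`‖x i‖ * ‖x i ^ 2‖ * ‖x i‖`. -/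
lemma norm_E_le_alpha₄ (P : OVCStarProbSpace A B) (x : Fin n → A) (i : Fin n) (b : B) :
    ‖P.E (x i * P.incl (star b) * x i ^ 2 * P.incl b * x i)‖ ≤ ‖b‖ ^ 2 * P.alpha₄ x := by
  rcases eq_or_ne b 0 with rfl | hb
  · simp
  have hn : 0 < ‖b‖ := norm_pos_iff.2 hb
  set c : B := ‖b‖⁻¹ • b with hc
  have hc1 : ‖c‖ = 1 := by rw [hc, norm_smul, norm_inv, norm_norm, inv_mul_cancel₀ hn.ne']
  have hbc : b = ‖b‖ • c := by rw [hc, smul_smul, mul_inv_cancel₀ hn.ne', one_smul]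
  have h1 : ‖P.E (x i * P.incl (star c) * x i ^ 2 * P.incl c * x i)‖ ≤ P.alpha₄ x := by
    refine le_trans ?_ (le_ciSup (f := fun i => ⨆ b : {b : B // ‖b‖ = 1},
      ‖P.E (x i * P.incl (star b.1) * x i ^ 2 * P.incl b.1 * x i)‖) (Set.finite_range _).bddAbove i)
    refine le_ciSup (f := fun b : {b : B // ‖b‖ = 1} =>
      ‖P.E (x i * P.incl (star b.1) * x i ^ 2 * P.incl b.1 * x i)‖) ?_ ⟨c, hc1⟩
    refine ⟨‖x i‖ * ‖x i ^ 2‖ * ‖x i‖, ?_⟩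
    rintro _ ⟨⟨d, hd⟩, rfl⟩
    refine (P.norm_E_le _).trans ?_
    refine (norm_mul₃_le).trans ?_
    refine mul_le_mul_of_nonneg_right ?_ (norm_nonneg _)
    refine (mul_le_mul_of_nonneg_right norm_mul₃_le (norm_nonneg _)).trans ?_
    rw [P.norm_incl, P.norm_incl, norm_star, hd, mul_one, mul_one]
  have h2 : x i * P.incl (star b) * x i ^ 2 * P.incl b * x i =
      (‖b‖ ^ 2) • (x i * P.incl (star c) * x i ^ 2 * P.incl c * x i) := by
    nth_rw 1 2 [hbc]
    simp only [star_smul, star_trivial, P.incl_real_smul, mul_smul_comm, smul_mul_assoc, smul_smul,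
      sq]
  rw [h2, P.E_real_smul, norm_smul, Real.norm_of_nonneg (by positivity)]
  gcongr

/-- Difference of the Cauchy transforms of a Boolean sum and of the Bernoulli element with the same
variance. -/
lemma BooleanIndep.exists_cauchyTransform_sub_eq (hn : 0 < n) (h : P.BooleanIndep x)
    (hx : ∀ i, IsSelfAdjoint (x i)) (hx0 : ∀ i, P.E (x i) = 0)
    (hy : IsSelfAdjoint y) (hB : P'.IsBernoulli (P.avgVariance x) y)
    {b : B} (hb : b ∈ opUpperHalfPlane B) {γ : ℝ}
    (hγ : ∀ i, ‖P.E (x i * P.incl (Ring.inverse b) * x i ^ 2 *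
      P.incl (star (Ring.inverse b)) * x i)‖ ≤ γ) :
    ∃ D : B, P.cauchyTransform (normalizedSum x) b - P'.cauchyTransform y b =
        P.cauchyTransform (normalizedSum x) b * D * P'.cauchyTransform y b ∧
      ‖D‖ ≤ 1 / √(n : ℝ) * (‖Ring.inverse (ℑ b : B)‖ * √(P.alpha₂ x) * √γ) := by
  set r : ℝ := (√(n : ℝ))⁻¹ with hr
  have hn' : (0 : ℝ) < n := by exact_mod_cast hn
  have hr0 : 0 < r := by positivity
  have hrr : r ^ 2 = (n : ℝ)⁻¹ := by rw [hr, inv_pow, Real.sq_sqrt hn'.le]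
  have hxr : ∀ i, IsSelfAdjoint (r • x i) := fun i => (IsSelfAdjoint.all r).smul (hx i)
  have hxr0 : ∀ i, P.E (r • x i) = 0 := fun i => by rw [P.E_real_smul, hx0, smul_zero]
  have hmem : ∀ i, r • x i ∈ P.generated {x i} := fun i => by
    rw [← Complex.coe_smul]
    exact SMulMemClass.smul_mem _ (P.mem_generated rfl)
  choose u hu hu0 β hβ using fun i => P.exists_centered_solution hb (hxr i) (hmem i)
  have h1 := h.cauchyTransform_sum_mul hx hb r hu hu0 hβ
  have h2 := hB.mul_cauchyTransform hy hb
  set g := Ring.inverse b with hg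
  refine ⟨∑ i, β i - P.avgVariance x g, ?_, ?_⟩
  · set F := P.cauchyTransform (normalizedSum x) b
    set G := P'.cauchyTransform y b
    change F * (b - ∑ i, β i) = 1 at h1
    -- The one-sided inverse relations are on exactly the sides needed here.
    calc F - G = F * ((b - P.avgVariance x g) * G) - F * (b - ∑ i, β i) * G := by
          rw [h1, h2, mul_one, one_mul]
      _ = _ := by noncomm_ring
  · have h3 : ∑ i, β i - P.avgVariance x g =
        ∑ i, (β i - P.E ((r • x i) * P.incl g * (r • x i))) := by
      rw [Finset.sum_sub_distrib, avgVariance, Finset.smul_sum]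
      congr 1
      refine Finset.sum_congr rfl fun i _ => ?_
      rw [smul_mul_assoc, smul_mul_assoc, mul_smul_comm, smul_smul, P.E_real_smul, ← sq, hrr]
    have h4 : ∀ i, ‖β i - P.E ((r • x i) * P.incl g * (r • x i))‖ ≤
        ‖Ring.inverse (ℑ b : B)‖ * (r * √(P.alpha₂ x)) * (r ^ 2 * √γ) := by
      intro i
      refine (norm_sub_E_le_of_centered_solution hb (hxr i) (hxr0 i) (hu0 i) (hβ i)).trans ?_
      have h5 : √‖P.E ((r • x i) ^ 2)‖ ≤ r * √(P.alpha₂ x) := by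
        rw [smul_pow, P.E_real_smul, norm_smul, Real.norm_of_nonneg (by positivity),
          Real.sqrt_mul (by positivity), Real.sqrt_sq hr0.le]
        gcongr
        exact P.norm_E_sq_le_alpha₂ x i
      have h6 : √‖P.E ((r • x i) * P.incl g * (r • x i) ^ 2 * P.incl (star g) * (r • x i))‖ ≤
          r ^ 2 * √γ := by
        have h7 : (r • x i) * P.incl g * (r • x i) ^ 2 * P.incl (star g) * (r • x i) =
            ((r ^ 2) ^ 2) • (x i * P.incl g * x i ^ 2 * P.incl (star g) * x i) := by
          simp only [smul_pow, mul_smul_comm, smul_mul_assoc, smul_smul]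
          congr 1
          ring
        rw [h7, P.E_real_smul, norm_smul, Real.norm_of_nonneg (by positivity),
          Real.sqrt_mul (by positivity), Real.sqrt_sq (by positivity)]
        gcongr
        exact hγ i
      gcongr
    rw [h3]
    -- There are `n` terms of order `r ^ 3`, and `n * r ^ 2 = 1`, so one factor `r = 1/√n` survives.
    refine (norm_sum_le _ _).trans ((Finset.sum_le_sum fun i _ => h4 i).trans_eq ?_)
    rw [Finset.sum_const, Finset.card_univ, Fintype.card_fin, nsmul_eq_mul, hrr, one_div, ← hr]
    field_simp

lemma BooleanIndep.norm_cauchyTransform_sub_le (hn : 0 < n) (h : P.BooleanIndep x)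
    (hx : ∀ i, IsSelfAdjoint (x i)) (hx0 : ∀ i, P.E (x i) = 0)
    (hy : IsSelfAdjoint y) (hB : P'.IsBernoulli (P.avgVariance x) y)
    {b : B} (hb : b ∈ opUpperHalfPlane B) :
    ‖P.cauchyTransform (normalizedSum x) b - P'.cauchyTransform y b‖ ≤
      1 / √(n : ℝ) * ‖Ring.inverse (ℑ b : B)‖ ^ 4 * √(P.alpha₂ x) *
        (√(P.alpha₄ x) + P.alpha₂ x) := by
  set s := ‖Ring.inverse (ℑ b : B)‖ with hs
  have hX : IsSelfAdjoint (normalizedSum x) :=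
    (IsSelfAdjoint.all _).smul (isSelfAdjoint_sum _ fun i _ => hx i)
  have hα4 : 0 ≤ P.alpha₄ x :=
    Real.iSup_nonneg fun _ => Real.iSup_nonneg fun _ => norm_nonneg _
  have hγ : ∀ i, ‖P.E (x i * P.incl (Ring.inverse b) * x i ^ 2 *
      P.incl (star (Ring.inverse b)) * x i)‖ ≤ s ^ 2 * P.alpha₄ x := by
    intro i
    have h1 := P.norm_E_le_alpha₄ x i (star (Ring.inverse b))
    rw [star_star, norm_star] at h1
    refine h1.trans ?_
    gcongr
    exact norm_inverse_le hb
  obtain ⟨D, hD, hDn⟩ := h.exists_cauchyTransform_sub_eq hn hx hx0 hy hB hb hγ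
  rw [hD]
  refine norm_mul₃_le.trans ?_
  have hα2 := P.alpha₂_nonneg x
  calc _ ≤ s * (1 / √(n : ℝ) * (s * √(P.alpha₂ x) * √(s ^ 2 * P.alpha₄ x))) * s := by
        gcongr
        · exact P.norm_cauchyTransform_le hb hX
        · exact P'.norm_cauchyTransform_le hb hy
    _ = 1 / √(n : ℝ) * s ^ 4 * √(P.alpha₂ x) * √(P.alpha₄ x) := by
        rw [Real.sqrt_mul (by positivity), Real.sqrt_sq (norm_nonneg _)]
        ring
    -- The summand `α₂` of the stated bound is pure slack.
    _ ≤ _ := by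
        gcongr
        exact le_add_of_nonneg_right hα2

end Comparison

end OVCStarProbSpace

/-! ### From Poisson integrals to the Lévy distance -/

section Levy

open MeasureTheory Real Set

/-- The Poisson kernel of the upper half-plane, up to the factor `π`. -/
def halfPlaneKernel (ε u s : ℝ) : ℝ := ε / ((u - s) ^ 2 + ε ^ 2)

/-- The distribution function of a Cauchy law centered at `s`, at the point `t`. -/
def cauchyCDF (ε t s : ℝ) : ℝ := 1 / 2 + arctan ((t - s) / ε) / π

variable {ε : ℝ}

lemma halfPlaneKernel_nonneg (hε : 0 < ε) (u s : ℝ) : 0 ≤ halfPlaneKernel ε u s := by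
  unfold halfPlaneKernel; positivity

lemma continuous_halfPlaneKernel (hε : 0 < ε) :
    Continuous fun p : ℝ × ℝ => halfPlaneKernel ε p.1 p.2 := by
  unfold halfPlaneKernel
  exact continuous_const.div (by fun_prop) fun p => by positivity

lemma halfPlaneKernel_le (hε : 0 < ε) (u s : ℝ) : halfPlaneKernel ε u s ≤ ε⁻¹ := by
  unfold halfPlaneKernel
  rw [div_le_iff₀ (by positivity), inv_mul_eq_div, le_div_iff₀ hε]
  nlinarith [sq_nonneg (u - s)]

lemma halfPlaneKernel_eq (hε : 0 < ε) (u s : ℝ) :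
    halfPlaneKernel ε u s = ε⁻¹ * (1 + ((u - s) / ε) ^ 2)⁻¹ := by
  unfold halfPlaneKernel
  field_simp
  ring

lemma integrable_halfPlaneKernel (hε : 0 < ε) (s : ℝ) :
    Integrable fun u => halfPlaneKernel ε u s := by
  simp_rw [halfPlaneKernel_eq hε]
  exact ((integrable_inv_one_add_sq.comp_div hε.ne').comp_sub_right s).const_mul _

lemma hasDerivAt_arctan_sub_div (hε : 0 < ε) (u s : ℝ) :
    HasDerivAt (fun u => arctan ((u - s) / ε)) (halfPlaneKernel ε u s) u := by
  have h := (((hasDerivAt_id' u).sub_const s).div_const ε).arctan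
  rw [halfPlaneKernel_eq hε]
  convert h using 1
  ring

lemma integral_Iic_halfPlaneKernel (hε : 0 < ε) (t s : ℝ) :
    ∫ u in Iic t, halfPlaneKernel ε u s = π * cauchyCDF ε t s := by
  have hlim : Filter.Tendsto (fun u => arctan ((u - s) / ε)) Filter.atBot (nhds (-(π / 2))) := by
    refine (tendsto_nhds_of_tendsto_nhdsWithin tendsto_arctan_atBot).comp ?_
    exact (Filter.tendsto_atBot_add_const_right _ (-s) Filter.tendsto_id).atBot_div_const hε
  rw [integral_Iic_of_hasDerivAt_of_tendsto' (fun u _ => hasDerivAt_arctan_sub_div hε u s)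
    (integrable_halfPlaneKernel hε s).integrableOn hlim, cauchyCDF]
  field_simp
  ring

lemma cauchyCDF_nonneg (ε t s : ℝ) : 0 ≤ cauchyCDF ε t s := by
  have h := neg_pi_div_two_lt_arctan ((t - s) / ε)
  have : -(1 / 2) ≤ arctan ((t - s) / ε) / π := by
    rw [le_div_iff₀ pi_pos]; linarith
  unfold cauchyCDF; linarith

lemma cauchyCDF_le_one (ε t s : ℝ) : cauchyCDF ε t s ≤ 1 := by
  have h := arctan_lt_pi_div_two ((t - s) / ε)
  have : arctan ((t - s) / ε) / π ≤ 1 / 2 := by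
    rw [div_le_iff₀ pi_pos]; linarith
  unfold cauchyCDF; linarith

lemma continuous_cauchyCDF (ε t : ℝ) : Continuous (cauchyCDF ε t) := by
  unfold cauchyCDF; fun_prop

lemma pi_div_two_sub_inv_le_arctan {x : ℝ} (hx : 0 < x) : π / 2 - x⁻¹ ≤ arctan x := by
  have h1 := arctan_inv_of_pos hx
  have h2 : arctan x⁻¹ ≤ x⁻¹ := by
    have := le_tan (arctan_nonneg.2 (inv_pos.2 hx).le) (arctan_lt_pi_div_two _)
    rwa [tan_arctan] at this
  linarith

lemma one_sub_le_cauchyCDF (hε : 0 < ε) {t s r : ℝ} (hr : 0 < r) (h : s ≤ t - r) :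
    1 - ε / r ≤ cauchyCDF ε t s := by
  have h1 : arctan (r / ε) ≤ arctan ((t - s) / ε) := arctan_mono (by gcongr; linarith)
  have h2 := pi_div_two_sub_inv_le_arctan (div_pos hr hε)
  rw [inv_div] at h2
  have h3 : 1 / 2 - ε / r ≤ arctan ((t - s) / ε) / π := by
    rw [le_div_iff₀ pi_pos]
    have : ε / r ≤ ε / r * π := le_mul_of_one_le_right (by positivity) (by linarith [pi_gt_three])
    linarith
  unfold cauchyCDF; linarith

lemma cauchyCDF_le (hε : 0 < ε) {t s r : ℝ} (hr : 0 < r) (h : t + r ≤ s) :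
    cauchyCDF ε t s ≤ ε / r := by
  have h1 : arctan ((t - s) / ε) ≤ -arctan (r / ε) := by
    rw [← arctan_neg, ← neg_div]
    exact arctan_mono (by gcongr; linarith)
  have h2 := pi_div_two_sub_inv_le_arctan (div_pos hr hε)
  rw [inv_div] at h2
  have h3 : arctan ((t - s) / ε) / π ≤ ε / r - 1 / 2 := by
    rw [div_le_iff₀ pi_pos]
    have : ε / r ≤ ε / r * π := le_mul_of_one_le_right (by positivity) (by linarith [pi_gt_three])
    linarith
  unfold cauchyCDF; linarith

variable (μ ν : Measure ℝ) [IsProbabilityMeasure μ] [IsProbabilityMeasure ν]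

lemma integrable_cauchyCDF (ε t : ℝ) : Integrable (cauchyCDF ε t) μ :=
  Integrable.of_bound (continuous_cauchyCDF ε t).aestronglyMeasurable 1
    (.of_forall fun s => by
      rw [norm_of_nonneg (cauchyCDF_nonneg ε t s)]; exact cauchyCDF_le_one ε t s)

lemma integrable_prod_halfPlaneKernel (hε : 0 < ε) (t : ℝ) :
    Integrable (fun p : ℝ × ℝ => halfPlaneKernel ε p.1 p.2)
      ((volume.restrict (Iic t)).prod μ) := by
  rw [integrable_prod_iff' (continuous_halfPlaneKernel hε).aestronglyMeasurable]
  refine ⟨.of_forall fun s => (integrable_halfPlaneKernel hε s).integrableOn, ?_⟩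
  simp_rw [norm_of_nonneg (halfPlaneKernel_nonneg hε _ _), integral_Iic_halfPlaneKernel hε]
  exact (integrable_cauchyCDF μ ε t).const_mul _

lemma integrableOn_integral_halfPlaneKernel (hε : 0 < ε) (t : ℝ) :
    IntegrableOn (fun u => ∫ s, halfPlaneKernel ε u s ∂μ) (Iic t) :=
  (integrable_prod_halfPlaneKernel μ hε t).integral_prod_left

lemma integral_Iic_integral_halfPlaneKernel (hε : 0 < ε) (t : ℝ) :
    ∫ u in Iic t, ∫ s, halfPlaneKernel ε u s ∂μ = π * ∫ s, cauchyCDF ε t s ∂μ := by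
  rw [integral_integral_swap (integrable_prod_halfPlaneKernel μ hε t), ← integral_const_mul]
  simp_rw [integral_Iic_halfPlaneKernel hε]

lemma measureReal_Iic_sub_le_integral_cauchyCDF (hε : 0 < ε) {r : ℝ} (hr : 0 < r) (t : ℝ) :
    μ.real (Iic (t - r)) ≤ ∫ s, cauchyCDF ε t s ∂μ + ε / r := by
  have h1 : ∫ s, (Iic (t - r)).indicator 1 s ∂μ ≤ ∫ s, (cauchyCDF ε t s + ε / r) ∂μ := by
    refine integral_mono ((integrable_const (1 : ℝ)).indicator measurableSet_Iic)
      ((integrable_cauchyCDF μ ε t).add (integrable_const _)) fun s => ?_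
    by_cases hs : s ∈ Iic (t - r)
    · have := one_sub_le_cauchyCDF hε hr hs
      simp only [indicator_of_mem hs, Pi.one_apply]
      linarith
    · have := cauchyCDF_nonneg ε t s
      simp only [indicator_of_notMem hs]
      positivity
  rw [integral_indicator_one measurableSet_Iic,
    integral_add (integrable_cauchyCDF μ ε t) (integrable_const _)] at h1
  simpa using h1

lemma integral_cauchyCDF_le_measureReal_Iic_add (hε : 0 < ε) {r : ℝ} (hr : 0 < r) (t : ℝ) :
    ∫ s, cauchyCDF ε t s ∂μ ≤ μ.real (Iic (t + r)) + ε / r := by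
  have hi : Integrable ((Iic (t + r)).indicator (1 : ℝ → ℝ)) μ :=
    (integrable_const (1 : ℝ)).indicator measurableSet_Iic
  have h1 : ∫ s, cauchyCDF ε t s ∂μ ≤ ∫ s, ((Iic (t + r)).indicator 1 s + ε / r) ∂μ := by
    refine integral_mono (integrable_cauchyCDF μ ε t) (hi.add (integrable_const _)) fun s => ?_
    by_cases hs : s ∈ Iic (t + r)
    · have := cauchyCDF_le_one ε t s
      have : 0 < ε / r := by positivity
      simp only [indicator_of_mem hs, Pi.one_apply]
      linarith
    · have := cauchyCDF_le hε hr (not_le.1 hs).le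
      simp only [indicator_of_notMem hs]
      linarith
  rw [integral_add hi (integrable_const _), integral_indicator_one measurableSet_Iic] at h1
  simpa using h1

variable {μ ν}

/-- Integrating the hypothesis over `u ≤ t` turns each Poisson integral into `π` times a smoothed
distribution function, which is at most `1`; the constant `2` counts the two measures. -/
lemma abs_integral_cauchyCDF_sub_le (hε : 0 < ε) {κ : ℝ} (hκ : 0 ≤ κ)
    (h : ∀ u, |∫ s, halfPlaneKernel ε u s ∂μ - ∫ s, halfPlaneKernel ε u s ∂ν| ≤
      κ * (∫ s, halfPlaneKernel ε u s ∂μ + ∫ s, halfPlaneKernel ε u s ∂ν)) (t : ℝ) :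
    |∫ s, cauchyCDF ε t s ∂μ - ∫ s, cauchyCDF ε t s ∂ν| ≤ 2 * κ := by
  have hμ := integrableOn_integral_halfPlaneKernel μ hε t
  have hν := integrableOn_integral_halfPlaneKernel ν hε t
  have h1 : |π * ∫ s, cauchyCDF ε t s ∂μ - π * ∫ s, cauchyCDF ε t s ∂ν| ≤
      κ * (π * ∫ s, cauchyCDF ε t s ∂μ + π * ∫ s, cauchyCDF ε t s ∂ν) := by
    rw [← integral_Iic_integral_halfPlaneKernel μ hε t,
      ← integral_Iic_integral_halfPlaneKernel ν hε t, ← integral_sub hμ hν,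
      ← integral_add hμ hν, ← integral_const_mul]
    exact (abs_integral_le_integral_abs).trans
      (integral_mono (hμ.sub hν).abs ((hμ.add hν).const_mul κ) h)
  rw [← mul_sub, ← mul_add, abs_mul, abs_of_pos pi_pos] at h1
  have hle : ∀ (ρ : Measure ℝ) [IsProbabilityMeasure ρ], ∫ s, cauchyCDF ε t s ∂ρ ≤ 1 := by
    intro ρ _
    have := integral_mono (integrable_cauchyCDF ρ ε t) (integrable_const (1 : ℝ))
      (cauchyCDF_le_one ε t)
    simpa using this
  have h2 : π * |∫ s, cauchyCDF ε t s ∂μ - ∫ s, cauchyCDF ε t s ∂ν| ≤ π * (2 * κ) := by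
    refine h1.trans ?_
    have := hle μ
    have := hle ν
    calc _ ≤ κ * (π * (1 + 1)) := by gcongr
      _ = _ := by ring
  exact le_of_mul_le_mul_left h2 pi_pos

lemma levyDist_le_of_halfPlaneKernel (hε : 0 < ε) {κ : ℝ} (hκ : 0 ≤ κ)
    (h : ∀ u, |∫ s, halfPlaneKernel ε u s ∂μ - ∫ s, halfPlaneKernel ε u s ∂ν| ≤
      κ * (∫ s, halfPlaneKernel ε u s ∂μ + ∫ s, halfPlaneKernel ε u s ∂ν)) :
    levyDist μ ν ≤ 2 * √ε + 2 * κ := by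
  -- Unsmoothing with a shift `r` costs `r` in position and `ε / r` in mass; `r = √ε` equalizes
  -- them. It is done once for each measure, whence `2 * √ε`.
  have hr : 0 < √ε := sqrt_pos.2 hε
  have hdiv : ε / √ε = √ε := div_sqrt
  set e := 2 * √ε + 2 * κ
  have key := fun t => abs_le.1 (abs_integral_cauchyCDF_sub_le hε hκ h t)
  refine csInf_le ⟨0, fun _ hx => hx.1.le⟩ ⟨by positivity, fun t => ⟨?_, ?_⟩⟩
  · have h1 := measureReal_Iic_sub_le_integral_cauchyCDF μ hε hr (t - √ε)
    have h2 := integral_cauchyCDF_le_measureReal_Iic_add ν hε hr (t - √ε)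
    have h3 : μ.real (Iic (t - e)) ≤ μ.real (Iic (t - √ε - √ε)) :=
      measureReal_mono (Iic_subset_Iic.2 (by simp only [e]; linarith))
    rw [sub_add_cancel] at h2
    have := key (t - √ε)
    simp only [hdiv, e] at *
    linarith
  · have h1 := measureReal_Iic_sub_le_integral_cauchyCDF ν hε hr (t + √ε)
    have h2 := integral_cauchyCDF_le_measureReal_Iic_add μ hε hr (t + √ε)
    have h3 : μ.real (Iic (t + √ε + √ε)) ≤ μ.real (Iic (t + e)) :=
      measureReal_mono (Iic_subset_Iic.2 (by simp only [e]; linarith))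
    rw [add_sub_cancel_right] at h1
    have := key (t + √ε)
    simp only [hdiv, e] at *
    linarith

end Levy

/-! ### The distribution of a self-adjoint element as a probability measure -/

section Distribution

open MeasureTheory Set Filter

/-- A continuous cutoff: `1` on `[-k, k]`, `0` outside `[-k-1, k+1]`. -/
def cutoff (k : ℕ) (t : ℝ) : ℝ := max 0 (min 1 (k + 1 - |t|))

lemma continuous_cutoff (k : ℕ) : Continuous (cutoff k) := by
  unfold cutoff; fun_prop

lemma cutoff_nonneg (k : ℕ) (t : ℝ) : 0 ≤ cutoff k t := le_max_left _ _

lemma cutoff_le_one (k : ℕ) (t : ℝ) : cutoff k t ≤ 1 := max_le zero_le_one (min_le_left _ _)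

lemma cutoff_eq_one {k : ℕ} {t : ℝ} (h : |t| ≤ k) : cutoff k t = 1 := by
  rw [cutoff, min_eq_left (by linarith), max_eq_right zero_le_one]

lemma hasCompactSupport_cutoff (k : ℕ) : HasCompactSupport (cutoff k) := by
  refine .intro (isCompact_closedBall (0 : ℝ) (k + 1)) fun t ht => ?_
  rw [Metric.mem_closedBall, dist_zero_right, Real.norm_eq_abs, not_le] at ht
  exact max_eq_left ((min_le_right _ _).trans (by linarith))

/-- The product of a continuous function with a cutoff. -/
def cutoffMul (k : ℕ) {f : ℝ → ℝ} (hf : Continuous f) : C_c(ℝ, ℝ) where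
  toFun t := cutoff k t * f t
  continuous_toFun := (continuous_cutoff k).mul hf
  hasCompactSupport' := (hasCompactSupport_cutoff k).mul_right

variable {A : Type*} [CStarAlgebra A] [PartialOrder A] [StarOrderedRing A] (φ : A →ₚ[ℂ] ℂ) (x : A)

/-- The spectrum is compact, so the cutoff is eventually `1` on it and the functional calculus does
not see it. -/
lemma eventually_calculusFunctional_cutoffMul {f : ℝ → ℝ} (hf : Continuous f) :
    ∀ᶠ k in atTop, calculusFunctional φ x (cutoffMul k hf) = (φ (cfc f x)).re := by
  obtain ⟨R, hR⟩ := 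
    (ContinuousFunctionalCalculus.isCompact_spectrum (R := ℝ) x).isBounded.subset_closedBall 0
  filter_upwards [eventually_ge_atTop ⌈R⌉₊] with k hk
  change (φ (cfc (fun t => cutoff k t * f t) x)).re = _
  congr 2
  refine cfc_congr fun t ht => ?_
  have h1 := hR ht
  rw [Metric.mem_closedBall, dist_zero_right, Real.norm_eq_abs] at h1
  have h2 : (⌈R⌉₊ : ℝ) ≤ k := by exact_mod_cast hk
  rw [cutoff_eq_one (h1.trans ((Nat.le_ceil R).trans h2)), one_mul]

variable {φ} {x}

lemma distributionOf_univ_le_one (hφ : φ 1 = 1) (hx : IsSelfAdjoint x) :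
    distributionOf φ x univ ≤ 1 := by
  have hmono : Monotone fun k : ℕ => Metric.closedBall (0 : ℝ) k := fun i j hij =>
    Metric.closedBall_subset_closedBall (by exact_mod_cast hij)
  have hlim := tendsto_measure_iUnion_atTop (μ := distributionOf φ x) hmono
  rw [Metric.iUnion_closedBall_nat] at hlim
  refine le_of_tendsto hlim ?_
  filter_upwards [eventually_calculusFunctional_cutoffMul φ x (f := fun _ => 1) continuous_const]
    with k hk
  have h1 := RealRMK.rieszMeasure_le_of_eq_one (calculusFunctional φ x)
    (f := cutoffMul k (f := fun _ => 1) continuous_const)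
    (fun t => mul_nonneg (cutoff_nonneg k t) zero_le_one)
    (isCompact_closedBall (0 : ℝ) k) (fun t ht => by
      rw [Metric.mem_closedBall, dist_zero_right, Real.norm_eq_abs] at ht
      change cutoff k t * 1 = 1
      rw [cutoff_eq_one ht, one_mul])
  rw [hk, cfc_const_one ℝ x, hφ, Complex.one_re, ENNReal.ofReal_one] at h1
  exact h1

lemma integral_distributionOf (hφ : φ 1 = 1) (hx : IsSelfAdjoint x) {f : ℝ → ℝ}
    (hf : Continuous f) {C : ℝ} (hC : ∀ t, ‖f t‖ ≤ C) :
    ∫ t, f t ∂(distributionOf φ x) = (φ (cfc f x)).re := by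
  have : IsFiniteMeasure (distributionOf φ x) :=
    ⟨(distributionOf_univ_le_one hφ hx).trans_lt ENNReal.one_lt_top⟩
  have h1 : Tendsto (fun k => ∫ t, cutoff k t * f t ∂(distributionOf φ x)) atTop
      (nhds (∫ t, f t ∂(distributionOf φ x))) := by
    refine tendsto_integral_of_dominated_convergence (fun _ => C)
      (fun k => ((continuous_cutoff k).mul hf).aestronglyMeasurable) (integrable_const C)
      (fun k => .of_forall fun t => ?_) (.of_forall fun t => ?_)
    · rw [norm_mul, Real.norm_of_nonneg (cutoff_nonneg k t)]
      exact (mul_le_of_le_one_left (norm_nonneg _) (cutoff_le_one k t)).trans (hC t)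
    · refine tendsto_const_nhds.congr' ?_
      filter_upwards [eventually_ge_atTop ⌈|t|⌉₊] with k hk
      have h2 : (⌈|t|⌉₊ : ℝ) ≤ k := by exact_mod_cast hk
      rw [cutoff_eq_one ((Nat.le_ceil _).trans h2), one_mul]
  have h2 : (fun k => ∫ t, cutoff k t * f t ∂(distributionOf φ x)) =ᶠ[atTop]
      fun _ => (φ (cfc f x)).re := by
    filter_upwards [eventually_calculusFunctional_cutoffMul φ x hf] with k hk
    rw [← hk]
    exact RealRMK.integral_rieszMeasure (calculusFunctional φ x) (cutoffMul k hf)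
  exact tendsto_nhds_unique h1 (tendsto_const_nhds.congr' h2.symm)

lemma isProbabilityMeasure_distributionOf (hφ : φ 1 = 1) (hx : IsSelfAdjoint x) :
    IsProbabilityMeasure (distributionOf φ x) := by
  have : IsFiniteMeasure (distributionOf φ x) :=
    ⟨(distributionOf_univ_le_one hφ hx).trans_lt ENNReal.one_lt_top⟩
  have h := integral_distributionOf hφ hx (f := fun _ => 1) continuous_const (C := 1) (by simp)
  rw [cfc_const_one ℝ x, hφ] at h
  simp only [integral_const, smul_eq_mul, mul_one, Complex.one_re] at h
  exact ⟨by rwa [measureReal_def, ENNReal.toReal_eq_one_iff] at h⟩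

end Distribution

/-! ### The Poisson kernel in the functional calculus -/

section CStar

variable {A : Type*} [CStarAlgebra A]

lemma imaginaryPart_algebraMap_sub (u ε : ℝ) {x : A}
    (hx : IsSelfAdjoint x) :
    (ℑ (algebraMap ℂ A (u + ε * Complex.I) - x) : A) = ε • 1 := by
  have h1 : algebraMap ℂ A (u + ε * Complex.I) = (u + ε * Complex.I) • (1 : A) :=
    Algebra.algebraMap_eq_smul_one _
  rw [map_sub, hx.imaginaryPart, sub_zero, h1, imaginaryPart_smul]
  simp [(IsSelfAdjoint.one A).imaginaryPart]

/-- The denominator of the kernel at `x` is `N* N = N N*`, where `N = u + iε - x` has inverse `R`.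
Both orders are needed: `R R*` for the sum and `R* R` for the Bernoulli element. -/
lemma cfc_halfPlaneKernel {ε : ℝ} (hε : 0 < ε) (u : ℝ) {x R : A} (hx : IsSelfAdjoint x)
    (h₁ : (algebraMap ℂ A (u + ε * Complex.I) - x) * R = 1)
    (h₂ : R * (algebraMap ℂ A (u + ε * Complex.I) - x) = 1) :
    cfc (halfPlaneKernel ε u) x = ε • (star R * R) ∧
      cfc (halfPlaneKernel ε u) x = ε • (R * star R) := by
  set N := algebraMap ℂ A (u + ε * Complex.I) - x with hN
  have hNs : star N = algebraMap ℂ A (u - ε * Complex.I) - x := by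
    rw [hN, star_sub, hx.star_eq, ← algebraMap_star_comm]
    simp [sub_eq_add_neg]
  have hM : cfc (fun s => (u - s) ^ 2 + ε ^ 2) x = star N * N := by
    rw [cfc_add x (fun s => (u - s) ^ 2) (fun _ => ε ^ 2),
      cfc_pow (fun s => u - s) 2 x, cfc_sub (fun _ => u) (fun s => s) x, cfc_const u x,
      cfc_const (ε ^ 2) x, cfc_id' ℝ x, hNs, hN]
    simp only [map_add, map_sub, Algebra.algebraMap_eq_smul_one, mul_sub,
      sub_mul, mul_add, smul_mul_assoc, mul_smul_comm, one_mul, mul_one, sq, ← Complex.coe_smul]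
    match_scalars
    · linear_combination (ε : ℂ) ^ 2 * Complex.I_sq
    all_goals ring1
  have hcomm : star N * N = N * star N := by
    rw [hNs, hN]
    exact ((Algebra.commute_algebraMap_left _ _).sub_left
      ((Algebra.commute_algebraMap_right _ x).sub_right (Commute.refl x))).eq
  have hk : cfc (halfPlaneKernel ε u) x * (star N * N) = ε • (1 : A) := by
    rw [← hM, ← cfc_mul (halfPlaneKernel ε u) (fun s => (u - s) ^ 2 + ε ^ 2) x
      (by exact (continuous_halfPlaneKernel hε).comp (by fun_prop : Continuous fun s : ℝ => (u, s))
        |>.continuousOn)]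
    rw [← Algebra.algebraMap_eq_smul_one, ← cfc_const ε x]
    congr 1
    ext s
    have : (u - s) ^ 2 + ε ^ 2 ≠ 0 := by positivity
    rw [halfPlaneKernel, div_mul_cancel₀ _ this]
  have h₁' : star R * star N = 1 := by rw [← star_mul, h₁, star_one]
  have h₂' : star N * star R = 1 := by rw [← star_mul, h₂, star_one]
  constructor
  · calc cfc (halfPlaneKernel ε u) x
        = cfc (halfPlaneKernel ε u) x * (N * (star N * star R) * R) := by
          rw [h₂', mul_one, h₁, mul_one]
      _ = cfc (halfPlaneKernel ε u) x * (star N * N) * (star R * R) := by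
          rw [hcomm]; noncomm_ring
      _ = _ := by rw [hk, smul_mul_assoc, one_mul]
  · calc cfc (halfPlaneKernel ε u) x
        = cfc (halfPlaneKernel ε u) x * (star N * (N * R) * star R) := by
          rw [h₁, mul_one, h₂', mul_one]
      _ = cfc (halfPlaneKernel ε u) x * (star N * N) * (R * star R) := by noncomm_ring
      _ = _ := by rw [hk, smul_mul_assoc, one_mul]

end CStar

/-! ### Scalar points of the half-plane and Cauchy–Schwarz for a state -/

section Resolvent

variable {A : Type*} [CStarAlgebra A] [PartialOrder A] [StarOrderedRing A]

lemma mem_opUpperHalfPlane_algebraMap (u : ℝ) {ε : ℝ} (hε : 0 < ε) :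
    algebraMap ℂ A (u + ε * Complex.I) ∈ opUpperHalfPlane A := by
  have h := imaginaryPart_algebraMap_sub (A := A) u ε (IsSelfAdjoint.zero A)
  rw [sub_zero] at h
  change IsStrictlyPositive _
  rw [h]
  exact isStrictlyPositive_one.smul hε

lemma norm_inverse_imaginaryPart_algebraMap_le (u : ℝ) {ε : ℝ} (hε : 0 < ε) :
    ‖Ring.inverse (ℑ (algebraMap ℂ A (u + ε * Complex.I)) : A)‖ ≤ ε⁻¹ := by
  have h := imaginaryPart_algebraMap_sub (A := A) u ε (IsSelfAdjoint.zero A)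
  rw [sub_zero] at h
  rw [h]
  have h1 : Ring.inverse (ε • (1 : A)) = ε⁻¹ • 1 := by
    have h2 : (ε⁻¹ • (1 : A)) * (ε • 1) = 1 := by simp [smul_smul, hε.ne']
    have h3 : IsUnit (ε • (1 : A)) := (isStrictlyPositive_one.smul hε).isUnit
    have h4 := congrArg (· * Ring.inverse (ε • (1 : A))) h2
    simpa only [Ring.mul_inverse_cancel_right _ _ h3, one_mul] using h4.symm
  rw [h1, norm_smul, Real.norm_of_nonneg (by positivity)]
  refine mul_le_of_le_one_right (by positivity) ?_
  rcases subsingleton_or_nontrivial A with h | h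
  · simp [Subsingleton.elim (1 : A) 0]
  · simp

lemma integral_halfPlaneKernel_distributionOf {φ : A →ₚ[ℂ] ℂ} (hφ : φ 1 = 1) {x : A}
    (hx : IsSelfAdjoint x) {ε : ℝ} (hε : 0 < ε) (u : ℝ) :
    ∫ s, halfPlaneKernel ε u s ∂(distributionOf φ x) = (φ (cfc (halfPlaneKernel ε u) x)).re :=
  integral_distributionOf hφ hx
    ((continuous_halfPlaneKernel hε).comp (by fun_prop : Continuous fun s : ℝ => (u, s)))
    (C := ε⁻¹) fun s => by
      rw [Real.norm_of_nonneg (halfPlaneKernel_nonneg hε u s)]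
      exact halfPlaneKernel_le hε u s

/-- Positivity of `φ` on the square of `t a + i c`; the weight `t` stays free for later balancing.
-/
lemma two_mul_im_le (φ : A →ₚ[ℂ] ℂ) (t : ℝ) (a c : A) :
    2 * t * (φ (star a * c)).im ≤ t ^ 2 * (φ (star a * a)).re + (φ (star c * c)).re := by
  have h0 : 0 ≤ φ (star (t • a + Complex.I • c) * (t • a + Complex.I • c)) :=
    map_nonneg φ (star_mul_self_nonneg _)
  have h1 : star (t • a + Complex.I • c) * (t • a + Complex.I • c) =
      ((t ^ 2 : ℝ) : ℂ) • (star a * a) + (t * Complex.I) • (star a * c) -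
        (t * Complex.I) • star (star a * c) + star c * c := by
    simp only [← Complex.coe_smul, star_add, star_smul, star_mul, star_star, add_mul, mul_add,
      smul_mul_assoc, mul_smul_comm, Complex.star_def, Complex.conj_I,
      Complex.conj_ofReal]
    match_scalars
    · ring1
    · ring1
    · ring1
    · linear_combination -Complex.I_sq
  rw [h1, map_add, map_sub, map_add, map_smul, map_smul, map_smul, map_star] at h0
  have h2 := (Complex.le_def.1 h0).1
  simp at h2
  simp only [← Complex.ofReal_pow, Complex.ofReal_re, Complex.ofReal_im] at h2
  linarith

lemma two_mul_abs_im_le (φ : A →ₚ[ℂ] ℂ) (t : ℝ) (a c : A) :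
    2 * t * |(φ (star a * c)).im| ≤ t ^ 2 * (φ (star a * a)).re + (φ (star c * c)).re := by
  rcases abs_cases (φ (star a * c)).im with ⟨h, _⟩ | ⟨h, _⟩
  · rw [h]; exact two_mul_im_le φ t a c
  · have := two_mul_im_le φ (-t) a c
    rw [h]
    nlinarith

end Resolvent

/-! ### The Lévy distance estimate -/

namespace OVCStarProbSpace

variable {A B A' : Type*} [CStarAlgebra A] [PartialOrder A] [StarOrderedRing A]
  [CStarAlgebra B] [PartialOrder B] [StarOrderedRing B]
  [CStarAlgebra A'] [PartialOrder A'] [StarOrderedRing A']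
  {P : OVCStarProbSpace A B} {P' : OVCStarProbSpace A' B}

lemma resolvent_algebraMap (P : OVCStarProbSpace A B) {ε : ℝ} (hε : 0 < ε) (u : ℝ) {x : A}
    (hx : IsSelfAdjoint x) {R : A}
    (hR : R = Ring.inverse (P.incl (algebraMap ℂ B (u + ε * Complex.I)) - x)) :
    cfc (halfPlaneKernel ε u) x = ε • (star R * R) ∧
      cfc (halfPlaneKernel ε u) x = ε • (R * star R) := by
  have hu := P.isUnit_incl_sub (mem_opUpperHalfPlane_algebraMap u hε) hx
  have hincl : P.incl (algebraMap ℂ B (u + ε * Complex.I)) =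
    algebraMap ℂ A (u + ε * Complex.I) := AlgHomClass.commutes _ _
  rw [hincl] at hu hR
  refine cfc_halfPlaneKernel hε u hx ?_ ?_
  · rw [hR, Ring.mul_inverse_cancel _ hu]
  · rw [hR, Ring.inverse_mul_cancel _ hu]

lemma re_cfc_halfPlaneKernel_eq (P : OVCStarProbSpace A B) (φ : A →ₚ[ℂ] ℂ)
    (hφE : ∀ a, φ (P.incl (P.E a)) = φ a) {ε : ℝ} (hε : 0 < ε) (u : ℝ) {x : A}
    (hx : IsSelfAdjoint x) :
    (φ (cfc (halfPlaneKernel ε u) x)).re =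
      -(φ (P.incl (P.cauchyTransform x (algebraMap ℂ B (u + ε * Complex.I))))).im := by
  have hb := mem_opUpperHalfPlane_algebraMap (A := B) u hε
  have hu := P.isUnit_incl_sub hb hx
  have hincl : P.incl (algebraMap ℂ B (u + ε * Complex.I)) =
    algebraMap ℂ A (u + ε * Complex.I) := AlgHomClass.commutes _ _
  rw [cauchyTransform, hφE, (P.resolvent_algebraMap hε u hx rfl).1]
  have h1 := imaginaryPart_neg_inverse hu
  nth_rw 3 [hincl] at h1
  rw [imaginaryPart_algebraMap_sub u ε hx, mul_smul_comm, mul_one, smul_mul_assoc] at h1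
  have h2 : ∀ w : ℂ, (ℑ w : ℂ).re = w.im := fun w => by
    simp [imaginaryPart_apply_coe]
    ring
  rw [← h1, map_imaginaryPart, h2, map_neg, Complex.neg_im]

/-- Weighted Cauchy–Schwarz, followed by `E[R] E[R]* ≤ E[R R*]` and its analogue for `R'`. The norm
of `D` enters the second term as `d ^ 2`, so the weight `t = d` makes both terms carry `d ^ 2`. -/
lemma abs_im_le_of_cauchyTransform_sub_eq {φ : A →ₚ[ℂ] ℂ} {φ' : A' →ₚ[ℂ] ℂ}
    (hφE : ∀ a, φ (P.incl (P.E a)) = φ a) (hφE' : ∀ a, φ' (P'.incl (P'.E a)) = φ' a)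
    (hφφ' : ∀ b, φ' (P'.incl b) = φ (P.incl b)) {d : ℝ} (hd : 0 < d) {D : B} (hD : ‖D‖ ≤ d)
    (R : A) (R' : A') :
    |(φ (P.incl (P.E R * D * P'.E R'))).im| ≤
      d / 2 * ((φ (R * star R)).re + (φ' (star R' * R')).re) := by
  have h1 := two_mul_abs_im_le φ d (P.incl (star (P.E R))) (P.incl (D * P'.E R'))
  have h2 : (φ (star (P.incl (star (P.E R))) * P.incl (star (P.E R)))).re ≤
      (φ (R * star R)).re := by
    rw [← map_star, ← map_mul, ← hφE (R * star R), ← P.E_star]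
    have h3 := P.star_E_mul_E_self_le (star R)
    rw [star_star] at h3
    exact (Complex.le_def.1 (OrderHomClass.mono φ (OrderHomClass.mono P.incl h3))).1
  have h4 : (φ (star (P.incl (D * P'.E R')) * P.incl (D * P'.E R'))).re ≤
      d ^ 2 * (φ' (star R' * R')).re := by
    have h5 : star (D * P'.E R') * (D * P'.E R') ≤ (d ^ 2) • P'.E (star R' * R') := by
      have h6 : star D * D ≤ algebraMap ℝ B (d ^ 2) := by
        refine (IsSelfAdjoint.star_mul_self D).le_algebraMap_norm_self.trans
          (algebraMap_mono B ?_)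
        rw [CStarRing.norm_star_mul_self, ← sq]
        gcongr
      have h7 := star_left_conjugate_le_conjugate h6 (P'.E R')
      rw [Algebra.algebraMap_eq_smul_one, mul_smul_comm, mul_one, smul_mul_assoc] at h7
      calc _ = star (P'.E R') * (star D * D) * P'.E R' := by rw [star_mul]; noncomm_ring
        _ ≤ _ := h7.trans (smul_le_smul_of_nonneg_left (P'.star_E_mul_E_self_le R') (sq_nonneg d))
    rw [← map_star, ← map_mul]
    have h8 := (Complex.le_def.1 (OrderHomClass.mono φ (OrderHomClass.mono P.incl h5))).1
    rw [P.incl_real_smul, ← Complex.coe_smul, map_smul, ← hφφ' (P'.E _), hφE', smul_eq_mul,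
      Complex.re_ofReal_mul] at h8
    exact h8
  rw [← map_star, ← map_mul, star_star, ← mul_assoc] at h1
  have h9 : d ^ 2 * (φ (star (P.incl (star (P.E R))) * P.incl (star (P.E R)))).re ≤
      d ^ 2 * (φ (R * star R)).re := by gcongr
  rw [← map_star] at h9
  rw [star_star] at h9
  rw [← map_mul] at h9
  rw [← map_mul] at h1
  refine le_of_mul_le_mul_left ?_ (show 0 < 2 * d by positivity)
  linarith

variable {n : ℕ} {x : Fin n → A} {y : A'}

lemma BooleanIndep.levyDist_le_two_mul_sqrt_add (hn : 0 < n) (h : P.BooleanIndep x)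
    (hx : ∀ i, IsSelfAdjoint (x i)) (hx0 : ∀ i, P.E (x i) = 0)
    (hy : IsSelfAdjoint y) (hB : P'.IsBernoulli (P.avgVariance x) y)
    {φ : A →ₚ[ℂ] ℂ} {φ' : A' →ₚ[ℂ] ℂ} (hφ : φ 1 = 1) (hφ' : φ' 1 = 1)
    (hφE : ∀ a, φ (P.incl (P.E a)) = φ a) (hφE' : ∀ a, φ' (P'.incl (P'.E a)) = φ' a)
    (hφφ' : ∀ b, φ' (P'.incl b) = φ (P.incl b)) {ε : ℝ} (hε : 0 < ε) {K : ℝ}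
    (hK : 1 / √(n : ℝ) * (√(P.alpha₂ x) * √(P.alphaTilde₄ x)) < K) :
    levyDist (distributionOf φ (normalizedSum x)) (distributionOf φ' y) ≤
      2 * √ε + K / ε ^ 3 := by
  have hX : IsSelfAdjoint (normalizedSum x) :=
    (IsSelfAdjoint.all _).smul (isSelfAdjoint_sum _ fun i _ => hx i)
  have := isProbabilityMeasure_distributionOf hφ hX
  have := isProbabilityMeasure_distributionOf hφ' hy
  have hK0 : 0 < K := lt_of_le_of_lt (by positivity) hK
  have hκ : K / ε ^ 3 = 2 * (K / ε ^ 2 / 2 / ε) := by field_simp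
  rw [hκ]
  refine levyDist_le_of_halfPlaneKernel hε (by positivity) fun u => ?_
  set b := algebraMap ℂ B (u + ε * Complex.I) with hb
  have hbm : b ∈ opUpperHalfPlane B := mem_opUpperHalfPlane_algebraMap u hε
  have hs : ‖Ring.inverse (ℑ b : B)‖ ≤ ε⁻¹ := norm_inverse_imaginaryPart_algebraMap_le u hε
  -- Here `b` is scalar, so `b⁻¹` commutes past `x i` and the fourth moment `α̃₄` replaces `α₄`.
  have hγ : ∀ i, ‖P.E (x i * P.incl (Ring.inverse b) * x i ^ 2 *
      P.incl (star (Ring.inverse b)) * x i)‖ ≤ (ε⁻¹) ^ 2 * P.alphaTilde₄ x := by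
    intro i
    set z : ℂ := u + ε * Complex.I with hz
    have hz0 : z ≠ 0 := fun h0 => hε.ne' (by simpa [hz] using congrArg Complex.im h0)
    have hg : Ring.inverse b = algebraMap ℂ B z⁻¹ := by
      have h1 : b * algebraMap ℂ B z⁻¹ = 1 := by
        rw [hb, ← map_mul, mul_inv_cancel₀ hz0, map_one]
      have := congrArg (Ring.inverse b * ·) h1
      simpa only [Ring.inverse_mul_cancel_left _ _ (isUnit_of_mem hbm), mul_one] using this.symm
    have h1 : x i * P.incl (Ring.inverse b) * x i ^ 2 * P.incl (star (Ring.inverse b)) * x i =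
        (z⁻¹ * star z⁻¹) • x i ^ 4 := by
      rw [hg, ← algebraMap_star_comm, AlgHomClass.commutes, AlgHomClass.commutes]
      simp only [Algebra.algebraMap_eq_smul_one, mul_smul_comm, smul_mul_assoc, mul_one, smul_smul]
      congr 1
      · ring
      · simp only [pow_succ, pow_zero, one_mul, mul_assoc]
    have h2 : ‖z⁻¹‖ ≤ ε⁻¹ := by
      rw [norm_inv]
      gcongr
      have := Complex.abs_im_le_norm z
      simp only [hz, Complex.add_im, Complex.ofReal_im, Complex.mul_im, Complex.ofReal_re,
        Complex.I_im, Complex.I_re, mul_one, mul_zero, add_zero, zero_add, abs_of_pos hε] at this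
      exact this
    rw [h1, map_smul, norm_smul, norm_mul, norm_star, ← sq]
    gcongr
    exact P.norm_E_pow_four_le_alphaTilde₄ x i
  obtain ⟨D, hD, hDn⟩ := h.exists_cauchyTransform_sub_eq hn hx hx0 hy hB hbm hγ
  have hD' : ‖D‖ ≤ K / ε ^ 2 := by
    refine hDn.trans ?_
    rw [Real.sqrt_mul (by positivity), Real.sqrt_sq (by positivity)]
    calc _ ≤ 1 / √(n : ℝ) * (ε⁻¹ * √(P.alpha₂ x) * (ε⁻¹ * √(P.alphaTilde₄ x))) := by gcongr
      _ = 1 / √(n : ℝ) * (√(P.alpha₂ x) * √(P.alphaTilde₄ x)) / ε ^ 2 := by field_simp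
      _ ≤ _ := by gcongr
  have h3 := abs_im_le_of_cauchyTransform_sub_eq hφE hφE' hφφ' (by positivity) hD'
    (Ring.inverse (P.incl b - normalizedSum x)) (Ring.inverse (P'.incl b - y))
  have h4 : (φ (cfc (halfPlaneKernel ε u) (normalizedSum x))).re =
      ε * (φ (Ring.inverse (P.incl b - normalizedSum x) *
        star (Ring.inverse (P.incl b - normalizedSum x)))).re := by
    rw [(P.resolvent_algebraMap hε u hX rfl).2, ← Complex.coe_smul, map_smul, smul_eq_mul,
      Complex.re_ofReal_mul]
  have h5 : (φ' (cfc (halfPlaneKernel ε u) y)).re =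
      ε * (φ' (star (Ring.inverse (P'.incl b - y)) * Ring.inverse (P'.incl b - y))).re := by
    rw [(P'.resolvent_algebraMap hε u hy rfl).1, ← Complex.coe_smul, map_smul, smul_eq_mul,
      Complex.re_ofReal_mul]
  have h6 : (φ (cfc (halfPlaneKernel ε u) (normalizedSum x))).re -
      (φ' (cfc (halfPlaneKernel ε u) y)).re =
      -(φ (P.incl (P.cauchyTransform (normalizedSum x) b * D * P'.cauchyTransform y b))).im := by
    rw [← hD, P.re_cfc_halfPlaneKernel_eq φ hφE hε u hX,
      P'.re_cfc_halfPlaneKernel_eq φ' hφE' hε u hy, hφφ', map_sub, map_sub, Complex.sub_im]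
    ring
  rw [integral_halfPlaneKernel_distributionOf hφ hX hε,
    integral_halfPlaneKernel_distributionOf hφ' hy hε, h6, abs_neg, h4, h5]
  refine h3.trans_eq ?_
  field_simp

lemma BooleanIndep.levyDist_le (hn : 0 < n) (h : P.BooleanIndep x)
    (hx : ∀ i, IsSelfAdjoint (x i)) (hx0 : ∀ i, P.E (x i) = 0)
    (hy : IsSelfAdjoint y) (hB : P'.IsBernoulli (P.avgVariance x) y)
    {φ : A →ₚ[ℂ] ℂ} {φ' : A' →ₚ[ℂ] ℂ} (hφ : φ 1 = 1) (hφ' : φ' 1 = 1)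
    (hφE : ∀ a, φ (P.incl (P.E a)) = φ a) (hφE' : ∀ a, φ' (P'.incl (P'.E a)) = φ' a)
    (hφφ' : ∀ b, φ' (P'.incl b) = φ (P.incl b)) :
    levyDist (distributionOf φ (normalizedSum x)) (distributionOf φ' y) ≤
      3 * (P.alpha₂ x * (P.alphaTilde₄ x + P.alpha₂ x ^ 2)) ^ (1 / 14 : ℝ) *
        (n : ℝ) ^ (-(1 / 14) : ℝ) := by
  have hα2 := P.alpha₂_nonneg x
  have hα4 := P.alphaTilde₄_nonneg x
  set M := P.alpha₂ x * (P.alphaTilde₄ x + P.alpha₂ x ^ 2) with hM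
  have hM0 : 0 ≤ M := by positivity
  set a₀ := M ^ (1 / 14 : ℝ) * (n : ℝ) ^ (-(1 / 14) : ℝ) with ha₀
  have ha₀0 : 0 ≤ a₀ := by positivity
  have hpow : a₀ ^ 7 = 1 / √(n : ℝ) * √M := by
    rw [ha₀, mul_pow, ← Real.rpow_natCast, ← Real.rpow_natCast, ← Real.rpow_mul hM0,
      ← Real.rpow_mul (Nat.cast_nonneg n), Real.sqrt_eq_rpow, Real.sqrt_eq_rpow, one_div (_ ^ _),
      ← Real.rpow_neg (Nat.cast_nonneg n), mul_comm]
    norm_num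
  have hA : 1 / √(n : ℝ) * (√(P.alpha₂ x) * √(P.alphaTilde₄ x)) ≤ a₀ ^ 7 := by
    rw [hpow, ← Real.sqrt_mul hα2]
    gcongr
    rw [hM]
    gcongr
    exact le_add_of_nonneg_right (by positivity)
  -- Taking `a` strictly above `a₀` keeps `ε` positive even when `a₀ = 0`.
  have key : ∀ a, a₀ < a →
      levyDist (distributionOf φ (normalizedSum x)) (distributionOf φ' y) ≤ 3 * a := by
    intro a ha
    have ha0 : 0 < a := ha₀0.trans_lt ha
    -- With `ε = a ^ 2` and `K = a ^ 7` both errors are multiples of `a`: `2 * √ε + K / ε ^ 3 = 2 *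
    -- a + a`, hence the constant `3`.
    have h1 := h.levyDist_le_two_mul_sqrt_add hn hx hx0 hy hB hφ hφ' hφE hφE' hφφ'
      (ε := a ^ 2) (by positivity) (K := a ^ 7)
      (hA.trans_lt (pow_lt_pow_left₀ ha ha₀0 (by norm_num)))
    rw [Real.sqrt_sq ha0.le] at h1
    refine h1.trans_eq ?_
    field_simp
    norm_num
  rw [mul_assoc]
  refine ge_of_tendsto (x := nhdsWithin a₀ (Set.Ioi a₀)) (f := fun a => 3 * a) ?_
    (eventually_nhdsWithin_of_forall key)
  exact tendsto_nhdsWithin_of_tendsto_nhds ((continuous_const.mul continuous_id).tendsto _)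

end OVCStarProbSpace

end

theorem mainTheorem4 :
    ∃ c : ℝ, 0 < c ∧
      ∀ (A B A' : Type*) [CStarAlgebra A] [PartialOrder A] [StarOrderedRing A]
        [CStarAlgebra B] [PartialOrder B] [StarOrderedRing B]
        [CStarAlgebra A'] [PartialOrder A'] [StarOrderedRing A']
        (P : OVCStarProbSpace A B) (P' : OVCStarProbSpace A' B)
        (n : ℕ) (_ : 0 < n) (x : Fin n → A) (_ : ∀ j, IsSelfAdjoint (x j))
        (_ : P.BooleanIndep x) (_ : ∀ j, P.E (x j) = 0)
        (Bn : A') (_ : IsSelfAdjoint Bn) (_ : P'.IsBernoulli (P.avgVariance x) Bn),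
        (∀ b ∈ opUpperHalfPlane B,
          ‖P.cauchyTransform (OVCStarProbSpace.normalizedSum x) b - P'.cauchyTransform Bn b‖ ≤
            1 / √(n : ℝ) * ‖Ring.inverse (ℑ b : B)‖ ^ 4 * √(P.alpha₂ x) *
              (√(P.alpha₄ x) + P.alpha₂ x)) ∧
        (∀ (φ : A →ₚ[ℂ] ℂ) (φ' : A' →ₚ[ℂ] ℂ) (_ : φ 1 = 1) (_ : φ' 1 = 1)
          (_ : ∀ a, φ (P.incl (P.E a)) = φ a) (_ : ∀ a, φ' (P'.incl (P'.E a)) = φ' a)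
          (_ : ∀ b, φ' (P'.incl b) = φ (P.incl b)),
          levyDist (distributionOf φ (OVCStarProbSpace.normalizedSum x))
              (distributionOf φ' Bn) ≤
            c * (P.alpha₂ x * (P.alphaTilde₄ x + P.alpha₂ x ^ 2)) ^ (1 / 14 : ℝ) *
              (n : ℝ) ^ (-(1 / 14) : ℝ)) := by
  refine ⟨3, by norm_num, ?_⟩
  intro A B A' _ _ _ _ _ _ _ _ _ P P' n hn x hx hI hx0 Bn hBn hB
  exact ⟨fun b hb => hI.norm_cauchyTransform_sub_le hn hx hx0 hBn hB hb,
    fun φ φ' hφ hφ' hφE hφE' hφφ' =>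
      hI.levyDist_le hn hx hx0 hBn hB hφ hφ' hφE hφE' hφφ'⟩
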